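/- **Theorem (Typing ensures runtime safety).** Consider the following session $\pi$-calculus with locations and updates. *Processes.* Let $a,x,\dots$ range over names, $\kappa^p$ over polarized channels ($p\in\{+,-\}$, with $\overline p$ the opposite polarity), $k$ over names and polarized channels, $l$ over locations, $n$ over labels and $\mathsf X$ over process variables. Constants $c$ are integers, booleans and names. Expressions $e$ are built from constants by arithmetic, comparison and boolean operators, and $e\downarrow c$ denotes evaluation. Processes are: session acceptance $\mathsf{acc}\,a(x).P$, request $\mathsf{req}\,a(x).P$ and replicated acceptance $!\mathsf{acc}\,a(x).P$; located processes $l_h[P]$, with an integer annotation $h$; process variables $\mathsf X$; updates $l\{P(\mathsf X)\}$; $k!(\tilde e).P$, $k?(\tilde x).P$, $\mathsf{throw}\,k[k'].P$, $\mathsf{catch}\,k(x).P$, $k\triangleright\{n_j{:}P_j\}_{j\in J}$ (with $J$ finite), $k\triangleleft n;P$ and $\mathsf{close}(k).P$; $P\mid Q$, $\mathsf{if}\ e\ \mathsf{then}\ P\ \mathsf{else}\ Q$, $(\nu\kappa)P$ and $\mathbf 0$. Structural congruence $\equiv$ is the least congruence that contains $\alpha$-conversion, the commutative monoid laws for $(\mid,\mathbf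 0)$, $(\nu\kappa)\mathbf 0\equiv\mathbf 0$, $(\nu\kappa)(\nu\kappa')P\equiv(\nu\kappa')(\nu\kappa)P$, $(\nu\kappa)P\mid Q\equiv(\nu\kappa)(P\mid Q)$ for $\kappa$ not free in $Q$, and $(\nu\kappa)l_h[P]\equiv l_h[(\nu\kappa)P]$. *Reduction.* Contexts are $C,D,E::=\{\bullet\}\mid l_h[C\mid P]$; $C^{\pm}$ (resp. $C^{\pm\pm}$) changes all annotations on the path to the hole by $\pm1$ (resp. $\pm2$). Reduction $\longrightarrow$ is the least relation that is closed under $\equiv$, parallel composition and restriction and satisfies, with $\kappa$ fresh in the first two lines: - $E\{C\{\mathsf{acc}\,a(x).P\}\mid D\{\mathsf{req}\,a(y).Q\}\}\longrightarrow E^{++}\{(\nu\kappa)(C^+\{P\{\kappa^+/x\}\}\mid D^+\{Q\{\kappa^- /y\}\})\}$; - the same with $!\mathsf{acc}\,a(x).P$ in place of $\mathsf{acc}\,a(x).P$, the hole of $C^+$ being filled with $P\{\kappa^+/x\}\mid{!\mathsf{acc}\,a(x).P}$; - $E\{C\{l_0[Q]\}\mid D\{l\{P(\mathsf X)\}\}\}\longrightarrow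 E\{C\{P\{Q/\mathsf X\}\}\mid D\{\mathbf 0\}\}$; - $E\{C\{\kappa^p!(\tilde e).P\}\mid D\{\kappa^{\overline p}?(\tilde x).Q\}\}\longrightarrow E\{C\{P\}\mid D\{Q\{\tilde c/\tilde x\}\}\}$ if $\tilde e\downarrow\tilde c$ and $|\tilde x|=|\tilde c|$; - $E\{C\{\mathsf{throw}\,\kappa^p[\kappa'^q].P\}\mid D\{\mathsf{catch}\,\kappa^{\overline p}(x).Q\}\}\longrightarrow E\{C^-\{P\}\mid D^+\{Q\{\kappa'^q/x\}\}\}$; - $E\{C\{\kappa^p\triangleright\{n_j{:}P_j\}_{j\in J}\}\mid D\{\kappa^{\overline p}\triangleleft n_i;Q\}\}\longrightarrow E\{C\{P_i\}\mid D\{Q\}\}$ for $i\in J$; - $E\{C\{\mathsf{close}(\kappa^p).P\}\mid D\{\mathsf{close}(\kappa^{\overline p}).Q\}\}\longrightarrow E^{--}\{C^-\{P\}\mid D^-\{Q\}\}$; - $C\{\mathsf{if}\ e\ \mathsf{then}\ P\ \mathsf{else}\ Q\}\longrightarrow C\{P\}$ if $e\downarrow\mathsf{true}$, and $\longrightarrow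 C\{Q\}$ if $e\downarrow\mathsf{false}$. *Types.* Session types are $\alpha,\beta::={!(\tilde\tau).\alpha}\mid{?(\tilde\tau).\alpha}\mid{!(\beta).\alpha}\mid{?(\beta).\alpha}\mid\&\{n_j{:}\alpha_j\}_{j\in J}\mid\oplus\{n_j{:}\alpha_j\}_{j\in J}\mid\epsilon$, where the $\tau$ are basic types ($\mathsf{int}$, $\mathsf{bool}$, …); the dual $\overline\alpha$ exchanges $!$ with $?$ and $\&$ with $\oplus$ along $\alpha$. An interface $I$ assigns to each declaration $a{:}\alpha$ a multiplicity in $\mathbb N\cup\{\infty\}$; sums $I\uplus I'$ and the preorder $I\sqsubseteq I'$ are pointwise, and $I^\infty$ replaces each nonzero multiplicity by $\infty$. A typing $\Delta$ is a finite collection of assignments $k{:}\alpha$ and bracketed assignments $[\kappa^p{:}\alpha]$, $|\Delta|$ is the number of its assignments, and $\mathrm{dom}(\Delta)$ is the set of all $k$ with an unbracketed $k{:}\alpha\in\Delta$. It is *balanced* if $\kappa^p{:}\alpha\in\Delta$ implies $\kappa^{\overline p}{:}\overline\alpha\in\Delta$, and $[\kappa^p{:}\alpha]\in\Delta$ implies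 $[\kappa^{\overline p}{:}\overline\alpha]\in\Delta$. $\Gamma$ assigns to names basic types or pairs $\langle\alpha_q,\overline\alpha_{q'}\rangle$ with $q,q'\in\{\mathsf{lin},\mathsf{un}\}$, and $\Theta$ assigns interfaces to process variables and locations. The judgment $\Gamma;\Theta\vdash P\triangleright\Delta;I$ is inductively defined by the following rules, in which "$P\triangleright\Delta;I$" abbreviates "$\Gamma;\Theta\vdash P\triangleright\Delta;I$", bound names are fresh, and an environment is displayed where it changes: - $\mathbf 0\triangleright\emptyset;\emptyset$, and $\mathsf X\triangleright\emptyset;I$ if $\Theta(\mathsf X)=I$; - if $P\triangleright\Delta,x{:}\alpha;I$ and $\Gamma(a)=\langle\alpha_{\mathsf{lin}},\overline\alpha_q\rangle$, then $\mathsf{acc}\,a(x).P\triangleright\Delta;I\uplus\langle a{:}\alpha,1\rangle$; - if $P\triangleright x{:}\alpha;I$ and $\Gamma(a)=\langle\alpha_{\mathsf{un}},\overline\alpha_q\rangle$, then $!\mathsf{acc}\,a(x).P\triangleright\emptyset;I^\infty\uplus\langle a{:}\alpha,\infty\rangle$; - if $P\triangleright\Delta,x{:}\overline\alpha;I$ and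 $\Gamma(a)=\langle\alpha_q,\overline\alpha_{\mathsf{lin}}\rangle$, then $\mathsf{req}\,a(x).P\triangleright\Delta;I\uplus\langle a{:}\overline\alpha,1\rangle$; - if $\Theta(l)=I$, $P\triangleright\Delta;I'$, $h=|\Delta|$ and $I'\sqsubseteq I$, then $l_h[P]\triangleright\Delta;I'$; - if $\Theta(l)=I$ and $\Gamma;\Theta,\mathsf X{:}I\vdash P\triangleright\emptyset;I'$, then $l\{P(\mathsf X)\}\triangleright\emptyset;\emptyset$; - if $P\triangleright\Delta,k{:}\alpha;I$ and $\Gamma\vdash\tilde e:\tilde\tau$, then $k!(\tilde e).P\triangleright\Delta,k{:}{!(\tilde\tau).\alpha};I$; - if $\Gamma,\tilde x{:}\tilde\tau;\Theta\vdash P\triangleright\Delta,k{:}\alpha;I$, then $k?(\tilde x).P\triangleright\Delta,k{:}{?(\tilde\tau).\alpha};I$; - if $P\triangleright\Delta,k{:}\alpha;I$ and $k'\notin\mathrm{dom}(\Delta)\cup\{k\}$, then $\mathsf{throw}\,k[k'].P\triangleright\Delta,k{:}{!(\beta).\alpha},k'{:}\beta;I$; - if $P\triangleright\Delta,k{:}\alpha,x{:}\beta;I$,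 then $\mathsf{catch}\,k(x).P\triangleright\Delta,k{:}{?(\beta).\alpha};I$; - if $J\neq\emptyset$ and $P_j\triangleright\Delta,k{:}\alpha_j;I$ for all $j\in J$, then $k\triangleright\{n_j{:}P_j\}_{j\in J}\triangleright\Delta,k{:}\&\{n_j{:}\alpha_j\}_{j\in J};I$; - if $P\triangleright\Delta,k{:}\alpha_i;I$ and $i\in J$, then $k\triangleleft n_i;P\triangleright\Delta,k{:}\oplus\{n_j{:}\alpha_j\}_{j\in J};I$; - if $P\triangleright\Delta;I$ and $k\notin\mathrm{dom}(\Delta)$, then $\mathsf{close}(k).P\triangleright\Delta,k{:}\epsilon;I$; - if $P\triangleright\Delta_1;I_1$ and $Q\triangleright\Delta_2;I_2$ have disjoint domains, then $P\mid Q\triangleright\Delta_1,\Delta_2;I_1\uplus I_2$; - if $\Gamma\vdash e:\mathsf{bool}$, $P\triangleright\Delta;I$ and $Q\triangleright\Delta;I$, then $\mathsf{if}\ e\ \mathsf{then}\ P\ \mathsf{else}\ Q\triangleright\Delta;I$; - if $P\triangleright\Delta,\kappa^-{:}\alpha,\kappa^+{:}\overline\alpha;I$, then $(\nu\kappa)P\triangleright\Delta,[\kappa^-{:}\alpha],[\kappa^+{:}\overline\alpha];I$;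 if $P\triangleright\Delta;I$ and $\kappa^+,\kappa^-$ do not occur in $\Delta$, then $(\nu\kappa)P\triangleright\Delta;I$; - if $P\triangleright\Delta;I$, then $P\triangleright\Delta,[\kappa^-{:}\alpha],[\kappa^+{:}\overline\alpha];I$ for $\kappa$ not occurring in $\Delta$; if $P\triangleright\Delta;I$ and $I\sqsubseteq I'$, then $P\triangleright\Delta;I'$. *Errors.* A $\kappa$-process is a process prefixed by a send, receive, throw, catch, selection, branching or close whose subject is $\kappa^+$ or $\kappa^-$. A process contains it if it occurs in it below parallel compositions, locations and restrictions only. Two $\kappa$-processes form a $\kappa$-redex if their subjects have opposite polarities and they are a send and a receive of equal arity, a throw and a catch, a selection and a branching that offers the selected label, or two closes. A process is an *error* if it is structurally congruent to a process $(\nu\tilde\kappa)Q$ such that, for some channel $\kappa$, $Q$ contains either exactly two $\kappa$-processes, which do not form a $\kappa$-redex, or three or more $\kappa$-processes. *Statement.* If $\Gamma;\Theta\vdash P\triangleright\Delta;I$ with $\Delta$ balanced, then $P$ never reduces to an error: whenever $P\longrightarrow^*Q$, the process $Q$ is not an error. -/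

import Mathlib

namespace SessAdapt

/-! Base sets. Names, labels and locations are drawn from countable sets. Bound names, bound
channels and bound process variables are de Bruijn indices, so that alpha-equivalent processes
are equal; a free name is an atom `nm a`, and every index may also be free. -/

abbrev Name := ℕ
abbrev Label := ℕ
abbrev Loc := ℕ

/-- Polarities of channel endpoints. -/
inductive Pol where
  | pos
  | neg

/-- The opposite polarity. -/
def Pol.opp : Pol → Pol
  | .pos => .neg
  | .neg => .pos

/-- What may be substituted for a name: free names `nm a`, bound names (variables) `var i`,
polarized channels `ch κ p`, and integer and boolean constants. -/
inductive Val where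
  | nm (a : Name)
  | var (i : ℕ)
  | ch (κ : ℕ) (p : Pol)
  | int (z : ℤ)
  | bool (b : Bool)

/-- The metavariable `k` of the calculus ranges over names and polarized channels. -/
def Val.IsKey : Val → Prop
  | .nm _ => True
  | .var _ => True
  | .ch _ _ => True
  | .int _ => False
  | .bool _ => False

/-- The constants are the integers, the booleans and the names. -/
def Val.IsConst : Val → Prop
  | .ch _ _ => False
  | _ => True

/-- Substitution of values for variables (`σ`), with a renaming of channels (`ρ`). -/
def Val.subst (σ : ℕ → Val) (ρ : ℕ → ℕ) : Val → Val
  | .nm a => .nm a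
  | .var i => σ i
  | .ch κ p => .ch (ρ κ) p
  | .int z => .int z
  | .bool b => .bool b

/-- Add `n` to all variables. -/
def Val.shiftVar (n : ℕ) (v : Val) : Val := v.subst (fun i => .var (i + n)) id

/-- Add one to all channels. -/
def Val.shiftChan (v : Val) : Val := v.subst .var Nat.succ

/-- A substitution below a binder of `n` names. -/
def liftVar (n : ℕ) (σ : ℕ → Val) : ℕ → Val :=
  fun i => if i < n then .var i else (σ (i - n)).shiftVar n

/-- A renaming of indices below one binder. -/
def liftRen (ρ : ℕ → ℕ) : ℕ → ℕ
  | 0 => 0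
  | i + 1 => ρ i + 1

/-! Expressions. -/

inductive Expr where
  | val (v : Val)
  | add (e₁ e₂ : Expr)
  | sub (e₁ e₂ : Expr)
  | eq (e₁ e₂ : Expr)
  | le (e₁ e₂ : Expr)
  | and (e₁ e₂ : Expr)
  | not (e : Expr)

def Expr.subst (σ : ℕ → Val) (ρ : ℕ → ℕ) : Expr → Expr
  | .val v => .val (v.subst σ ρ)
  | .add e₁ e₂ => .add (e₁.subst σ ρ) (e₂.subst σ ρ)
  | .sub e₁ e₂ => .sub (e₁.subst σ ρ) (e₂.subst σ ρ)
  | .eq e₁ e₂ => .eq (e₁.subst σ ρ) (e₂.subst σ ρ)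
  | .le e₁ e₂ => .le (e₁.subst σ ρ) (e₂.subst σ ρ)
  | .and e₁ e₂ => .and (e₁.subst σ ρ) (e₂.subst σ ρ)
  | .not e => .not (e.subst σ ρ)

/-- Evaluation `e ↓ c` of expressions to constants. -/
inductive Eval : Expr → Val → Prop
  | val {v : Val} : v.IsConst → Eval (.val v) v
  | add {e₁ e₂ : Expr} {m n : ℤ} :
      Eval e₁ (.int m) → Eval e₂ (.int n) → Eval (.add e₁ e₂) (.int (m + n))
  | sub {e₁ e₂ : Expr} {m n : ℤ} :
      Eval e₁ (.int m) → Eval e₂ (.int n) → Eval (.sub e₁ e₂) (.int (m - n))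
  | eq {e₁ e₂ : Expr} {m n : ℤ} :
      Eval e₁ (.int m) → Eval e₂ (.int n) → Eval (.eq e₁ e₂) (.bool (decide (m = n)))
  | le {e₁ e₂ : Expr} {m n : ℤ} :
      Eval e₁ (.int m) → Eval e₂ (.int n) → Eval (.le e₁ e₂) (.bool (decide (m ≤ n)))
  | and {e₁ e₂ : Expr} {b c : Bool} :
      Eval e₁ (.bool b) → Eval e₂ (.bool c) → Eval (.and e₁ e₂) (.bool (b && c))
  | not {e : Expr} {b : Bool} : Eval e (.bool b) → Eval (.not e) (.bool (!b))

/-! Processes. Subjects are arbitrary values, which makes substitution total; processes whose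
subject is a literal neither reduce on it nor are typable. -/

inductive Proc where
  /-- session acceptance on `a`, binding one name -/
  | accept (a : Val) (P : Proc)
  /-- session request on `a`, binding one name -/
  | request (a : Val) (P : Proc)
  /-- replicated session acceptance on `a`, binding one name -/
  | repAccept (a : Val) (P : Proc)
  /-- located process at `l`, annotated with its number `h` of active sessions -/
  | loc (l : Loc) (h : ℤ) (P : Proc)
  /-- process variable -/
  | pvar (X : ℕ)
  /-- update process for location `l`, binding one process variable -/
  | adapt (l : Loc) (P : Proc)
  /-- output of a tuple of expressions -/
  | out (k : Val) (es : List Expr) (P : Proc)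
  /-- input of a tuple of length `n`, binding `n` names -/
  | inp (k : Val) (n : ℕ) (P : Proc)
  /-- session sending: `k'` is sent on `k` -/
  | throwS (k k' : Val) (P : Proc)
  /-- session reception on `k`, binding one name -/
  | catchS (k : Val) (P : Proc)
  /-- branching on a finite set of labels -/
  | branch (k : Val) (L : Finset Label) (P : {n // n ∈ L} → Proc)
  /-- label selection -/
  | select (k : Val) (n : Label) (P : Proc)
  | par (P Q : Proc)
  | ite (e : Expr) (P Q : Proc)
  /-- session closing -/
  | close (k : Val) (P : Proc)
  /-- restriction, binding one channel -/
  | res (P : Proc)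
  | nil

/-- Capture-avoiding substitution of values for variables, with a renaming of channels. -/
def Proc.subst : (ℕ → Val) → (ℕ → ℕ) → Proc → Proc
  | σ, ρ, .accept a P => .accept (a.subst σ ρ) (P.subst (liftVar 1 σ) ρ)
  | σ, ρ, .request a P => .request (a.subst σ ρ) (P.subst (liftVar 1 σ) ρ)
  | σ, ρ, .repAccept a P => .repAccept (a.subst σ ρ) (P.subst (liftVar 1 σ) ρ)
  | σ, ρ, .loc l h P => .loc l h (P.subst σ ρ)
  | _, _, .pvar X => .pvar X
  | σ, ρ, .adapt l P => .adapt l (P.subst σ ρ)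
  | σ, ρ, .out k es P => .out (k.subst σ ρ) (es.map (Expr.subst σ ρ)) (P.subst σ ρ)
  | σ, ρ, .inp k n P => .inp (k.subst σ ρ) n (P.subst (liftVar n σ) ρ)
  | σ, ρ, .throwS k k' P => .throwS (k.subst σ ρ) (k'.subst σ ρ) (P.subst σ ρ)
  | σ, ρ, .catchS k P => .catchS (k.subst σ ρ) (P.subst (liftVar 1 σ) ρ)
  | σ, ρ, .branch k L P => .branch (k.subst σ ρ) L (fun n => (P n).subst σ ρ)
  | σ, ρ, .select k n P => .select (k.subst σ ρ) n (P.subst σ ρ)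
  | σ, ρ, .par P Q => .par (P.subst σ ρ) (Q.subst σ ρ)
  | σ, ρ, .ite e P Q => .ite (e.subst σ ρ) (P.subst σ ρ) (Q.subst σ ρ)
  | σ, ρ, .close k P => .close (k.subst σ ρ) (P.subst σ ρ)
  | σ, ρ, .res P => .res (P.subst (fun i => (σ i).shiftChan) (liftRen ρ))
  | _, _, .nil => .nil

/-- Renaming of channels. -/
def Proc.renChan (ρ : ℕ → ℕ) (P : Proc) : Proc := P.subst .var ρ

/-- The process seen from below one further channel restriction. -/
def Proc.shiftChan (P : Proc) : Proc := P.renChan Nat.succ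

/-- The process seen from below a binder of `n` names. -/
def Proc.shiftVar (n : ℕ) (P : Proc) : Proc := P.subst (fun i => .var (i + n)) id

/-- `P{vs / x₀,…}`: instantiation of the outermost `vs.length` bound names. -/
def Proc.inst (P : Proc) (vs : List Val) : Proc :=
  P.subst (fun i => vs.getD i (.var (i - vs.length))) id

/-- Renaming of process variables. -/
def Proc.renPVar : (ℕ → ℕ) → Proc → Proc
  | ξ, .accept a P => .accept a (P.renPVar ξ)
  | ξ, .request a P => .request a (P.renPVar ξ)
  | ξ, .repAccept a P => .repAccept a (P.renPVar ξ)
  | ξ, .loc l h P => .loc l h (P.renPVar ξ)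
  | ξ, .pvar X => .pvar (ξ X)
  | ξ, .adapt l P => .adapt l (P.renPVar (liftRen ξ))
  | ξ, .out k es P => .out k es (P.renPVar ξ)
  | ξ, .inp k n P => .inp k n (P.renPVar ξ)
  | ξ, .throwS k k' P => .throwS k k' (P.renPVar ξ)
  | ξ, .catchS k P => .catchS k (P.renPVar ξ)
  | ξ, .branch k L P => .branch k L (fun n => (P n).renPVar ξ)
  | ξ, .select k n P => .select k n (P.renPVar ξ)
  | ξ, .par P Q => .par (P.renPVar ξ) (Q.renPVar ξ)
  | ξ, .ite e P Q => .ite e (P.renPVar ξ) (Q.renPVar ξ)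
  | ξ, .close k P => .close k (P.renPVar ξ)
  | ξ, .res P => .res (P.renPVar ξ)
  | _, .nil => .nil

/-- A substitution for process variables below a binder of a process variable. -/
def liftPVar (θ : ℕ → Proc) : ℕ → Proc
  | 0 => .pvar 0
  | i + 1 => (θ i).renPVar Nat.succ

/-- Capture-avoiding substitution of processes for process variables. -/
def Proc.substPVar : (ℕ → Proc) → Proc → Proc
  | θ, .accept a P => .accept a (P.substPVar (fun i => (θ i).shiftVar 1))
  | θ, .request a P => .request a (P.substPVar (fun i => (θ i).shiftVar 1))
  | θ, .repAccept a P => .repAccept a (P.substPVar (fun i => (θ i).shiftVar 1))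
  | θ, .loc l h P => .loc l h (P.substPVar θ)
  | θ, .pvar X => θ X
  | θ, .adapt l P => .adapt l (P.substPVar (liftPVar θ))
  | θ, .out k es P => .out k es (P.substPVar θ)
  | θ, .inp k n P => .inp k n (P.substPVar (fun i => (θ i).shiftVar n))
  | θ, .throwS k k' P => .throwS k k' (P.substPVar θ)
  | θ, .catchS k P => .catchS k (P.substPVar (fun i => (θ i).shiftVar 1))
  | θ, .branch k L P => .branch k L (fun n => (P n).substPVar θ)
  | θ, .select k n P => .select k n (P.substPVar θ)
  | θ, .par P Q => .par (P.substPVar θ) (Q.substPVar θ)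
  | θ, .ite e P Q => .ite e (P.substPVar θ) (Q.substPVar θ)
  | θ, .close k P => .close k (P.substPVar θ)
  | θ, .res P => .res (P.substPVar (fun i => (θ i).shiftChan))
  | _, .nil => .nil

/-- `P{Q / X}` for the outermost bound process variable `X` of `P`. -/
def Proc.instPVar (P Q : Proc) : Proc :=
  P.substPVar (fun i => match i with
    | 0 => Q
    | j + 1 => .pvar j)

/-- Exchange of the channels `0` and `1`. -/
def swap01 : ℕ → ℕ
  | 0 => 1
  | 1 => 0
  | i + 2 => i + 2

/-- Structural congruence: the least congruence with the commutative monoid laws for parallel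
composition, and scope extrusion for channels, also across locations. -/
inductive StrCong : Proc → Proc → Prop
  | refl (P : Proc) : StrCong P P
  | symm {P Q : Proc} : StrCong P Q → StrCong Q P
  | trans {P Q R : Proc} : StrCong P Q → StrCong Q R → StrCong P R
  | parComm (P Q : Proc) : StrCong (.par P Q) (.par Q P)
  | parAssoc (P Q R : Proc) : StrCong (.par (.par P Q) R) (.par P (.par Q R))
  | parNil (P : Proc) : StrCong (.par P .nil) P
  | resNil : StrCong (.res .nil) .nil
  | resSwap (P : Proc) : StrCong (.res (.res P)) (.res (.res (P.renChan swap01)))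
  | resPar (P Q : Proc) : StrCong (.par (.res P) Q) (.res (.par P Q.shiftChan))
  | resLoc (l : Loc) (h : ℤ) (P : Proc) : StrCong (.res (.loc l h P)) (.loc l h (.res P))
  | accept {P Q : Proc} (a : Val) : StrCong P Q → StrCong (.accept a P) (.accept a Q)
  | request {P Q : Proc} (a : Val) : StrCong P Q → StrCong (.request a P) (.request a Q)
  | repAccept {P Q : Proc} (a : Val) : StrCong P Q → StrCong (.repAccept a P) (.repAccept a Q)
  | loc {P Q : Proc} (l : Loc) (h : ℤ) : StrCong P Q → StrCong (.loc l h P) (.loc l h Q)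
  | adapt {P Q : Proc} (l : Loc) : StrCong P Q → StrCong (.adapt l P) (.adapt l Q)
  | out {P Q : Proc} (k : Val) (es : List Expr) :
      StrCong P Q → StrCong (.out k es P) (.out k es Q)
  | inp {P Q : Proc} (k : Val) (n : ℕ) : StrCong P Q → StrCong (.inp k n P) (.inp k n Q)
  | throwS {P Q : Proc} (k k' : Val) :
      StrCong P Q → StrCong (.throwS k k' P) (.throwS k k' Q)
  | catchS {P Q : Proc} (k : Val) : StrCong P Q → StrCong (.catchS k P) (.catchS k Q)
  | branch (k : Val) (L : Finset Label) {P Q : {n // n ∈ L} → Proc} :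
      (∀ n, StrCong (P n) (Q n)) → StrCong (.branch k L P) (.branch k L Q)
  | select {P Q : Proc} (k : Val) (n : Label) :
      StrCong P Q → StrCong (.select k n P) (.select k n Q)
  | par {P P' Q Q' : Proc} : StrCong P P' → StrCong Q Q' → StrCong (.par P Q) (.par P' Q')
  | ite {P P' Q Q' : Proc} (e : Expr) :
      StrCong P P' → StrCong Q Q' → StrCong (.ite e P Q) (.ite e P' Q')
  | close {P Q : Proc} (k : Val) : StrCong P Q → StrCong (.close k P) (.close k Q)
  | res {P Q : Proc} : StrCong P Q → StrCong (.res P) (.res Q)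

/-- Contexts of nested locations, `C ::= {•} | l_h[C | P]`. -/
inductive Ctx where
  | hole
  | loc (l : Loc) (h : ℤ) (C : Ctx) (P : Proc)

def Ctx.fill : Ctx → Proc → Proc
  | .hole, Q => Q
  | .loc l h C P, Q => .loc l h (.par (C.fill Q) P)

/-- Add `z` to all annotations along the path to the hole; `bump 1`, `bump (-1)`, `bump 2` and
`bump (-2)` are the operations written with superscripts `+`, `-`, `++` and `--`. -/
def Ctx.bump (z : ℤ) : Ctx → Ctx
  | .hole => .hole
  | .loc l h C P => .loc l (h + z) (C.bump z) P

/-- The context seen from below one further channel restriction. -/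
def Ctx.shiftChan : Ctx → Ctx
  | .hole => .hole
  | .loc l h C P => .loc l h C.shiftChan P.shiftChan

/-- The reduction relation. -/
inductive Red : Proc → Proc → Prop
  | openS (E C D : Ctx) (a : Name) (P Q : Proc) :
      Red (E.fill (.par (C.fill (.accept (.nm a) P)) (D.fill (.request (.nm a) Q))))
        ((E.bump 2).fill (.res (.par
          ((C.shiftChan.bump 1).fill (P.shiftChan.inst [.ch 0 .pos]))
          ((D.shiftChan.bump 1).fill (Q.shiftChan.inst [.ch 0 .neg])))))
  | repOpenS (E C D : Ctx) (a : Name) (P Q : Proc) :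
      Red (E.fill (.par (C.fill (.repAccept (.nm a) P)) (D.fill (.request (.nm a) Q))))
        ((E.bump 2).fill (.res (.par
          ((C.shiftChan.bump 1).fill
            (.par (P.shiftChan.inst [.ch 0 .pos]) (.repAccept (.nm a) P.shiftChan)))
          ((D.shiftChan.bump 1).fill (Q.shiftChan.inst [.ch 0 .neg])))))
  | upd (E C D : Ctx) (l : Loc) (P Q : Proc) :
      Red (E.fill (.par (C.fill (.loc l 0 Q)) (D.fill (.adapt l P))))
        (E.fill (.par (C.fill (P.instPVar Q)) (D.fill .nil)))
  | comm (E C D : Ctx) (κ : ℕ) (p : Pol) (es : List Expr) (cs : List Val) (P Q : Proc) :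
      List.Forall₂ Eval es cs →
      Red (E.fill (.par (C.fill (.out (.ch κ p) es P))
          (D.fill (.inp (.ch κ p.opp) cs.length Q))))
        (E.fill (.par (C.fill P) (D.fill (Q.inst cs))))
  | pass (E C D : Ctx) (κ κ' : ℕ) (p q : Pol) (P Q : Proc) :
      Red (E.fill (.par (C.fill (.throwS (.ch κ p) (.ch κ' q) P))
          (D.fill (.catchS (.ch κ p.opp) Q))))
        (E.fill (.par ((C.bump (-1)).fill P) ((D.bump 1).fill (Q.inst [.ch κ' q]))))
  | sel (E C D : Ctx) (κ : ℕ) (p : Pol) (L : Finset Label) (P : {n // n ∈ L} → Proc)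
      (n : Label) (hn : n ∈ L) (Q : Proc) :
      Red (E.fill (.par (C.fill (.branch (.ch κ p) L P))
          (D.fill (.select (.ch κ p.opp) n Q))))
        (E.fill (.par (C.fill (P ⟨n, hn⟩)) (D.fill Q)))
  | close (E C D : Ctx) (κ : ℕ) (p : Pol) (P Q : Proc) :
      Red (E.fill (.par (C.fill (.close (.ch κ p) P)) (D.fill (.close (.ch κ p.opp) Q))))
        ((E.bump (-2)).fill (.par ((C.bump (-1)).fill P) ((D.bump (-1)).fill Q)))
  | ifTr (C : Ctx) (e : Expr) (P Q : Proc) :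
      Eval e (.bool true) → Red (C.fill (.ite e P Q)) (C.fill P)
  | ifFa (C : Ctx) (e : Expr) (P Q : Proc) :
      Eval e (.bool false) → Red (C.fill (.ite e P Q)) (C.fill Q)
  | str {P P' Q' Q : Proc} : StrCong P P' → Red P' Q' → StrCong Q' Q → Red P Q
  | par {P P' : Proc} (Q : Proc) : Red P P' → Red (.par P Q) (.par P' Q)
  | res {P P' : Proc} : Red P P' → Red (.res P) (.res P')

/-! Types. -/

/-- Basic types; `other n` stands for further basic types, which are inhabited by names. -/
inductive BTy where
  | int
  | bool
  | other (n : ℕ)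

/-- Session types. -/
inductive STy where
  | send (τs : List BTy) (α : STy)
  | recv (τs : List BTy) (α : STy)
  | throwT (β α : STy)
  | catchT (β α : STy)
  | branch (L : Finset Label) (α : {n // n ∈ L} → STy)
  | select (L : Finset Label) (α : {n // n ∈ L} → STy)
  | closed

/-- Duality of session types. -/
def STy.dual : STy → STy
  | .send τs α => .recv τs α.dual
  | .recv τs α => .send τs α.dual
  | .throwT β α => .catchT β α.dual
  | .catchT β α => .throwT β α.dual
  | .branch L α => .select L (fun n => (α n).dual)
  | .select L α => .branch L (fun n => (α n).dual)
  | .closed => .closed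

/-- Type qualifiers, linear and unrestricted. -/
inductive Qual where
  | lin
  | un

/-- What a first-order environment assigns to a free name: a basic type, or a pair of qualified
session types, `service α q q'` being the pair of `α` qualified by `q` and the dual of `α`
qualified by `q'`. -/
inductive Entry where
  | basic (τ : BTy)
  | service (α : STy) (q q' : Qual)

/-- First-order environments. -/
structure Env where
  name : Name → Option Entry
  var : ℕ → Option BTy

/-- Extension by bound names of the given basic types. -/
def Env.bindVals (Γ : Env) (τs : List BTy) : Env where
  name := Γ.name
  var := fun i => if i < τs.length then τs[i]? else Γ.var (i - τs.length)

/-- The environment below the binder of a name that stands for a session; its type is recorded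
in the typing, not in the environment. -/
def Env.bindSess (Γ : Env) : Env where
  name := Γ.name
  var := fun i => match i with
    | 0 => none
    | j + 1 => Γ.var j

/-- Interfaces: `I a α` is the multiplicity, possibly infinite, with which the service `a` of
session type `α` is declared. The sum of interfaces and the preorder on them are the pointwise
ones. -/
abbrev Interface := Name → STy → ℕ∞

open Classical in
/-- The interface with the single declaration `⟨a : α, h⟩`. -/
noncomputable def Interface.single (a : Name) (α : STy) (h : ℕ∞) : Interface :=
  fun b β => if b = a ∧ β = α then h else 0

/-- All declared services become unrestricted. -/
noncomputable def Interface.unr (I : Interface) : Interface :=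
  fun a α => if I a α = 0 then 0 else ⊤

/-- Higher-order environments: interfaces of process variables and of locations. -/
structure HEnv where
  pvar : ℕ → Option Interface
  loc : Loc → Option Interface

/-- Extension by a process variable. -/
def HEnv.bindPVar (Θ : HEnv) (I : Interface) : HEnv where
  pvar := fun X => match X with
    | 0 => some I
    | Y + 1 => Θ.pvar Y
  loc := Θ.loc

/-- Assignments of typings: active assignments `k : α`, and bracketed assignments, which stand
for an endpoint of a restricted channel. As restricted channels are nameless, a bracketed
assignment only records the polarity and the type. -/
inductive Assign where
  | active (k : Val) (α : STy)
  | bracket (p : Pol) (α : STy)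

/-- Renaming of the subject of an assignment. -/
def Assign.mapKey (f : Val → Val) : Assign → Assign
  | .active k α => .active (f k) α
  | .bracket p α => .bracket p α

/-- Typings. -/
abbrev Typing := Multiset Assign

def Typing.shiftVar (n : ℕ) (Δ : Typing) : Typing := Δ.map (Assign.mapKey (Val.shiftVar n))

def Typing.shiftChan (Δ : Typing) : Typing := Δ.map (Assign.mapKey Val.shiftChan)

/-- `k ∈ dom Δ`. -/
def Typing.InDom (k : Val) (Δ : Typing) : Prop := ∃ α, Assign.active k α ∈ Δ

/-- Balanced typings. -/
def Typing.Balanced (Δ : Typing) : Prop :=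
  (∀ κ p α, Assign.active (.ch κ p) α ∈ Δ → Assign.active (.ch κ p.opp) α.dual ∈ Δ) ∧
  (∀ p α, Assign.bracket p α ∈ Δ → Assign.bracket p.opp α.dual ∈ Δ)

/-- Typing of expressions. -/
inductive ExprTyped (Γ : Env) : Expr → BTy → Prop
  | int (z : ℤ) : ExprTyped Γ (.val (.int z)) .int
  | bool (b : Bool) : ExprTyped Γ (.val (.bool b)) .bool
  | nm {a : Name} {τ : BTy} : Γ.name a = some (.basic τ) → ExprTyped Γ (.val (.nm a)) τ
  | var {i : ℕ} {τ : BTy} : Γ.var i = some τ → ExprTyped Γ (.val (.var i)) τ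
  | add {e₁ e₂ : Expr} : ExprTyped Γ e₁ .int → ExprTyped Γ e₂ .int → ExprTyped Γ (.add e₁ e₂) .int
  | sub {e₁ e₂ : Expr} : ExprTyped Γ e₁ .int → ExprTyped Γ e₂ .int → ExprTyped Γ (.sub e₁ e₂) .int
  | eq {e₁ e₂ : Expr} : ExprTyped Γ e₁ .int → ExprTyped Γ e₂ .int → ExprTyped Γ (.eq e₁ e₂) .bool
  | le {e₁ e₂ : Expr} : ExprTyped Γ e₁ .int → ExprTyped Γ e₂ .int → ExprTyped Γ (.le e₁ e₂) .bool
  | and {e₁ e₂ : Expr} :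
      ExprTyped Γ e₁ .bool → ExprTyped Γ e₂ .bool → ExprTyped Γ (.and e₁ e₂) .bool
  | not {e : Expr} : ExprTyped Γ e .bool → ExprTyped Γ (.not e) .bool

/-- The typing judgment `Γ; Θ ⊢ P ▷ Δ; I`. -/
inductive Typed : Env → HEnv → Proc → Typing → Interface → Prop
  | nil (Γ : Env) (Θ : HEnv) : Typed Γ Θ .nil 0 0
  | pvar {Γ : Env} {Θ : HEnv} {X : ℕ} {I : Interface} :
      Θ.pvar X = some I → Typed Γ Θ (.pvar X) 0 I
  | accept {Γ : Env} {Θ : HEnv} {a : Name} {α : STy} {q : Qual} {P : Proc} {Δ : Typing}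
      {I : Interface} :
      Γ.name a = some (.service α .lin q) →
      Typed Γ.bindSess Θ P (.active (.var 0) α ::ₘ Δ.shiftVar 1) I →
      Typed Γ Θ (.accept (.nm a) P) Δ (I + Interface.single a α 1)
  | repAccept {Γ : Env} {Θ : HEnv} {a : Name} {α : STy} {q : Qual} {P : Proc}
      {I : Interface} :
      Γ.name a = some (.service α .un q) →
      Typed Γ.bindSess Θ P {.active (.var 0) α} I →
      Typed Γ Θ (.repAccept (.nm a) P) 0 (I.unr + Interface.single a α ⊤)
  | request {Γ : Env} {Θ : HEnv} {a : Name} {α : STy} {q : Qual} {P : Proc} {Δ : Typing}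
      {I : Interface} :
      Γ.name a = some (.service α q .lin) →
      Typed Γ.bindSess Θ P (.active (.var 0) α.dual ::ₘ Δ.shiftVar 1) I →
      Typed Γ Θ (.request (.nm a) P) Δ (I + Interface.single a α.dual 1)
  | loc {Γ : Env} {Θ : HEnv} {l : Loc} {h : ℤ} {P : Proc} {Δ : Typing} {I I' : Interface} :
      Θ.loc l = some I → Typed Γ Θ P Δ I' → h = (Multiset.card Δ : ℤ) → I' ≤ I →
      Typed Γ Θ (.loc l h P) Δ I'
  | adapt {Γ : Env} {Θ : HEnv} {l : Loc} {P : Proc} {I I' : Interface} :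
      Θ.loc l = some I → Typed Γ (Θ.bindPVar I) P 0 I' → Typed Γ Θ (.adapt l P) 0 0
  | out {Γ : Env} {Θ : HEnv} {k : Val} {es : List Expr} {τs : List BTy} {P : Proc}
      {Δ : Typing} {α : STy} {I : Interface} :
      List.Forall₂ (ExprTyped Γ) es τs → Typed Γ Θ P (.active k α ::ₘ Δ) I →
      Typed Γ Θ (.out k es P) (.active k (.send τs α) ::ₘ Δ) I
  | inp {Γ : Env} {Θ : HEnv} {k : Val} {τs : List BTy} {P : Proc}
      {Δ : Typing} {α : STy} {I : Interface} :
      Typed (Γ.bindVals τs) Θ P (Typing.shiftVar τs.length (.active k α ::ₘ Δ)) I →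
      Typed Γ Θ (.inp k τs.length P) (.active k (.recv τs α) ::ₘ Δ) I
  | throwS {Γ : Env} {Θ : HEnv} {k k' : Val} {P : Proc} {Δ : Typing} {α β : STy}
      {I : Interface} :
      Typed Γ Θ P (.active k α ::ₘ Δ) I → k'.IsKey →
      ¬ Typing.InDom k' (.active k α ::ₘ Δ) →
      Typed Γ Θ (.throwS k k' P) (.active k (.throwT β α) ::ₘ .active k' β ::ₘ Δ) I
  | catchS {Γ : Env} {Θ : HEnv} {k : Val} {P : Proc} {Δ : Typing} {α β : STy}
      {I : Interface} :
      Typed Γ.bindSess Θ P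
        (.active (.var 0) β ::ₘ Typing.shiftVar 1 (.active k α ::ₘ Δ)) I →
      Typed Γ Θ (.catchS k P) (.active k (.catchT β α) ::ₘ Δ) I
  | branch {Γ : Env} {Θ : HEnv} {k : Val} {L : Finset Label} {P : {n // n ∈ L} → Proc}
      {Δ : Typing} {α : {n // n ∈ L} → STy} {I : Interface} :
      L.Nonempty → (∀ n, Typed Γ Θ (P n) (.active k (α n) ::ₘ Δ) I) →
      Typed Γ Θ (.branch k L P) (.active k (.branch L α) ::ₘ Δ) I
  | select {Γ : Env} {Θ : HEnv} {k : Val} {L : Finset Label} {n : Label} (hn : n ∈ L)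
      {P : Proc} {Δ : Typing} {α : {n // n ∈ L} → STy} {I : Interface} :
      Typed Γ Θ P (.active k (α ⟨n, hn⟩) ::ₘ Δ) I →
      Typed Γ Θ (.select k n P) (.active k (.select L α) ::ₘ Δ) I
  | par {Γ : Env} {Θ : HEnv} {P Q : Proc} {Δ₁ Δ₂ : Typing} {I₁ I₂ : Interface} :
      Typed Γ Θ P Δ₁ I₁ → Typed Γ Θ Q Δ₂ I₂ →
      (∀ k, Typing.InDom k Δ₁ → ¬ Typing.InDom k Δ₂) →
      Typed Γ Θ (.par P Q) (Δ₁ + Δ₂) (I₁ + I₂)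
  | ite {Γ : Env} {Θ : HEnv} {e : Expr} {P Q : Proc} {Δ : Typing} {I : Interface} :
      ExprTyped Γ e .bool → Typed Γ Θ P Δ I → Typed Γ Θ Q Δ I → Typed Γ Θ (.ite e P Q) Δ I
  | close {Γ : Env} {Θ : HEnv} {k : Val} {P : Proc} {Δ : Typing} {I : Interface} :
      Typed Γ Θ P Δ I → k.IsKey → ¬ Typing.InDom k Δ →
      Typed Γ Θ (.close k P) (.active k .closed ::ₘ Δ) I
  /-- restriction of an active session -/
  | res {Γ : Env} {Θ : HEnv} {P : Proc} {Δ : Typing} {α : STy} {I : Interface} :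
      Typed Γ Θ P
        (.active (.ch 0 .neg) α ::ₘ .active (.ch 0 .pos) α.dual ::ₘ Δ.shiftChan) I →
      Typed Γ Θ (.res P) (.bracket .neg α ::ₘ .bracket .pos α.dual ::ₘ Δ) I
  /-- restriction of a channel that is not in use, for instance after closing -/
  | resUnused {Γ : Env} {Θ : HEnv} {P : Proc} {Δ : Typing} {I : Interface} :
      Typed Γ Θ P Δ.shiftChan I → Typed Γ Θ (.res P) Δ I
  /-- weakening by a pair of dual bracketed assignments -/
  | weak {Γ : Env} {Θ : HEnv} {P : Proc} {Δ : Typing} {α : STy} {I : Interface} :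
      Typed Γ Θ P Δ I → Typed Γ Θ P (.bracket .neg α ::ₘ .bracket .pos α.dual ::ₘ Δ) I
  /-- subsumption for interfaces -/
  | subs {Γ : Env} {Θ : HEnv} {P : Proc} {Δ : Typing} {I I' : Interface} :
      Typed Γ Θ P Δ I → I ≤ I' → Typed Γ Θ P Δ I'

/-! Errors. -/

/-- The communication action offered by a prefixed process. -/
inductive Action where
  | out (n : ℕ)
  | inp (n : ℕ)
  | throwS
  | catchS
  | branch (L : Finset Label)
  | select (n : Label)
  | close

/-- One half of the complementarity of actions. -/
inductive Action.Matches : Action → Action → Prop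
  | comm (n : ℕ) : Matches (.out n) (.inp n)
  | pass : Matches .throwS .catchS
  | sel (L : Finset Label) (n : Label) : n ∈ L → Matches (.select n) (.branch L)
  | close : Matches .close .close

/-- Two processes with prefixes `x` and `y` on the same channel form a redex: they use opposite
endpoints and offer complementary actions. -/
def FormRedex (x y : Pol × Action) : Prop :=
  y.1 = x.1.opp ∧ (Action.Matches x.2 y.2 ∨ Action.Matches y.2 x.2)

open Classical in
/-- The singleton of `(p, A)` if `k` is the endpoint `p` of `κ`, and empty otherwise. -/
noncomputable def onChan (κ : ℕ) (k : Val) (A : Action) : Multiset (Pol × Action) :=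
  match k with
  | .ch κ' p => if κ' = κ then {(p, A)} else 0
  | _ => 0

/-- The `κ`-processes contained in a process, each represented by its endpoint and its action:
the prefixed processes with subject `κ` that occur below parallel compositions, locations and
restrictions only. -/
noncomputable def Proc.kprocs : ℕ → Proc → Multiset (Pol × Action)
  | κ, .out k es _ => onChan κ k (.out es.length)
  | κ, .inp k n _ => onChan κ k (.inp n)
  | κ, .throwS k _ _ => onChan κ k .throwS
  | κ, .catchS k _ => onChan κ k .catchS
  | κ, .branch k L _ => onChan κ k (.branch L)
  | κ, .select k n _ => onChan κ k (.select n)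
  | κ, .close k _ => onChan κ k .close
  | κ, .par P Q => P.kprocs κ + Q.kprocs κ
  | κ, .loc _ _ P => P.kprocs κ
  | κ, .res P => P.kprocs (κ + 1)
  | _, _ => 0

/-- Restriction of `n` channels. -/
def Proc.resN : ℕ → Proc → Proc
  | 0, P => P
  | n + 1, P => .res (P.resN n)

/-- A process is an error if it is structurally congruent to some `(ν κ₁) … (ν κₙ) Q` where, for
some channel `κ`, restricted here or free, `Q` contains exactly two `κ`-processes, which do not
form a redex, or at least three `κ`-processes. -/
def IsError (P : Proc) : Prop :=
  ∃ (n : ℕ) (Q : Proc) (κ : ℕ), StrCong P (Q.resN n) ∧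
    ((∃ x y, Q.kprocs κ = {x, y} ∧ ¬ FormRedex x y) ∨ 3 ≤ Multiset.card (Q.kprocs κ))

end SessAdapt

namespace SessAdapt

/-! Typing is linear. Every prefix needs its subject among the assigned keys, with a session type
that fits the prefix, and a parallel composition divides the keys between its two components. A
typable process therefore shows at most one prefix for each endpoint of a channel, hence at most two
for each channel. If there are two, they use opposite endpoints; when these have dual types, the two
prefixes form a redex (`WT.not_isError`). It remains to show that typability by an assignment with
dual endpoints is invariant under reduction.

Inversion of the original judgment is obstructed by weakening, subsumption and the two rules for
restriction. It is therefore replaced by `WT`, a recursive definition in which inversion is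
computation, and `Typed.wt` translates derivations into it. Interfaces are dropped, since they play
no role for the use of channels. Bracketed assignments are dropped too, except that they are
counted: the number `n` of all assignments is what location annotations record. Since weakening adds
brackets in pairs, surplus is absorbed by even numbers at the leaves and by a slack `2 * j` at
locations.

The count matters because of updates. The process `Q` in a location annotated with `0` is discarded
or copied arbitrarily, which is harmless only if it uses no session. This holds because the count
bounds the number of keys (`WT.cardLE`).

Three facts carry subject reduction (`Red.wt`). Substitution preserves `WT` as soon as it is
injective on the assigned keys (`WT.subst`). Structural congruence preserves `WT` in both
directions, with the same assignment and the same count (`StrCong.wt_iff`). The contents of the two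
holes around a redex can be replaced, the annotations following the change of the counts
(`WT.fill_par_fill`). The assignment may change during a reduction, but only at a channel both of
whose endpoints it contains, and then to dual types or to nothing (`Evolves`). Such a change cannot
be seen by a parallel process, and it preserves duality. -/

noncomputable instance : DecidableEq Val := Classical.decEq _

@[simp] theorem STy.dual_dual (α : STy) : α.dual.dual = α := by
  induction α <;> simp_all [STy.dual]

/-! Session assignments, the active part of a typing seen as a partial function. -/

abbrev Asg := Val → Option STy

/-- The assignment without keys. -/
def Asg.empty : Asg := fun _ => none

/-- The assignment below a binder of `n` names, which are assigned `o`. -/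
def Asg.bindVar (n : ℕ) (o : Option STy) (A : Asg) : Asg
  | .var i => if i < n then o else A (.var (i - n))
  | v => A v

/-- The assignment below a restriction, whose endpoints are assigned `o` and its dual. -/
def Asg.bindChan (o : Option STy) (A : Asg) : Asg
  | .ch 0 .neg => o
  | .ch 0 .pos => o.map STy.dual
  | .ch (κ + 1) p => A (.ch κ p)
  | v => A v

/-- `A` is the disjoint union of `B` and `C`. -/
def Split (A B C : Asg) : Prop :=
  ∀ k, (A k = B k ∧ C k = none) ∨ (A k = C k ∧ B k = none)

/-- A syntax-directed version of the typing judgment without interfaces. The bracketed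
assignments are not recorded; `n` is the number of all assignments. -/
def WT : Env → Proc → Asg → ℕ → Prop
  | Γ, .accept a P, A, n => ∃ b α q, a = .nm b ∧ Γ.name b = some (.service α .lin q) ∧
      WT Γ.bindSess P (A.bindVar 1 (some α)) (n + 1)
  | Γ, .request a P, A, n => ∃ b α q, a = .nm b ∧ Γ.name b = some (.service α q .lin) ∧
      WT Γ.bindSess P (A.bindVar 1 (some α.dual)) (n + 1)
  | Γ, .repAccept a P, A, n => A = Asg.empty ∧ Even n ∧ ∃ b α q, a = .nm b ∧
      Γ.name b = some (.service α .un q) ∧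
      WT Γ.bindSess P (Asg.empty.bindVar 1 (some α)) 1
  | Γ, .loc _ h P, A, n => ∃ m j : ℕ, h = m ∧ n = m + 2 * j ∧ WT Γ P A m
  | _, .pvar _, A, n => A = Asg.empty ∧ Even n
  | Γ, .adapt _ P, A, n => A = Asg.empty ∧ Even n ∧ WT Γ P Asg.empty 0
  | Γ, .out k es P, A, n => ∃ τs α, List.Forall₂ (ExprTyped Γ) es τs ∧
      A k = some (.send τs α) ∧ WT Γ P (Function.update A k (some α)) n
  | Γ, .inp k m P, A, n => ∃ τs α, τs.length = m ∧ A k = some (.recv τs α) ∧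
      WT (Γ.bindVals τs) P (Asg.bindVar m none (Function.update A k (some α))) n
  | Γ, .throwS k k' P, A, n => ∃ α β m, n = m + 1 ∧ k ≠ k' ∧ A k = some (.throwT β α) ∧
      A k' = some β ∧ WT Γ P (Function.update (Function.update A k (some α)) k' none) m
  | Γ, .catchS k P, A, n => ∃ α β, A k = some (.catchT β α) ∧
      WT Γ.bindSess P (Asg.bindVar 1 (some β) (Function.update A k (some α))) (n + 1)
  | Γ, .branch k L P, A, n => L.Nonempty ∧ ∃ α, A k = some (.branch L α) ∧
      ∀ i, WT Γ (P i) (Function.update A k (some (α i))) n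
  | Γ, .select k i P, A, n => ∃ L, ∃ α : {n // n ∈ L} → STy, ∃ h : i ∈ L,
      A k = some (.select L α) ∧ WT Γ P (Function.update A k (some (α ⟨i, h⟩))) n
  | Γ, .par P Q, A, n => ∃ B C m j, n = m + j ∧ Split A B C ∧ WT Γ P B m ∧ WT Γ Q C j
  | Γ, .ite e P Q, A, n => ExprTyped Γ e .bool ∧ WT Γ P A n ∧ WT Γ Q A n
  | Γ, .close k P, A, n => ∃ m, n = m + 1 ∧ A k = some .closed ∧
      WT Γ P (Function.update A k none) m
  | Γ, .res P, A, n => ∃ o, WT Γ P (A.bindChan o) n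
  | _, .nil, A, n => A = Asg.empty ∧ Even n

/-! Shifts of values. -/

@[simp] theorem Asg.bindVar_shiftVar (n : ℕ) (o : Option STy) (A : Asg) (v : Val) :
    A.bindVar n o (v.shiftVar n) = A v := by
  cases v <;> simp [Asg.bindVar, Val.shiftVar, Val.subst]

@[simp] theorem Asg.bindVar_ch (n : ℕ) (o : Option STy) (A : Asg) (κ : ℕ) (p : Pol) :
    A.bindVar n o (.ch κ p) = A (.ch κ p) := rfl

theorem Asg.bindVar_var {n i : ℕ} (h : i < n) (o : Option STy) (A : Asg) :
    A.bindVar n o (.var i) = o := by simp [Asg.bindVar, h]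

@[simp] theorem Asg.bindChan_shiftChan (o : Option STy) (A : Asg) (v : Val) :
    A.bindChan o v.shiftChan = A v := by
  cases v <;> simp [Asg.bindChan, Val.shiftChan, Val.subst]

@[simp] theorem Asg.bindChan_succ (o : Option STy) (A : Asg) (κ : ℕ) (p : Pol) :
    A.bindChan o (.ch (κ + 1) p) = A (.ch κ p) := by simp [Asg.bindChan]

@[simp] theorem Asg.bindChan_neg (o : Option STy) (A : Asg) :
    A.bindChan o (.ch 0 .neg) = o := rfl

@[simp] theorem Asg.bindChan_pos (o : Option STy) (A : Asg) :
    A.bindChan o (.ch 0 .pos) = o.map STy.dual := rfl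

theorem Val.shiftVar_injective (n : ℕ) : Function.Injective (Val.shiftVar n) := by
  intro v w; cases v <;> cases w <;> simp [Val.shiftVar, Val.subst]

theorem Val.shiftChan_injective : Function.Injective Val.shiftChan := by
  intro v w; cases v <;> cases w <;> simp +contextual [Val.shiftChan, Val.subst]

/-- With `Val.var_ne_shiftVar` and the injectivity of the shift, this splits the values below a
binder into the bound ones and a copy of the outer ones. Assignments below binders are compared on
the two parts separately. -/
theorem Val.bound_or_shiftVar (n : ℕ) (v : Val) :
    (∃ i < n, v = .var i) ∨ ∃ u : Val, v = u.shiftVar n := by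
  cases v with
  | var i =>
    by_cases h : i < n
    · exact .inl ⟨i, h, rfl⟩
    · exact .inr ⟨.var (i - n), by simp [Val.shiftVar, Val.subst]; omega⟩
  | nm a => exact .inr ⟨.nm a, rfl⟩
  | ch κ p => exact .inr ⟨.ch κ p, rfl⟩
  | int a => exact .inr ⟨.int a, rfl⟩
  | bool a => exact .inr ⟨.bool a, rfl⟩

theorem Val.bound_or_shiftChan (v : Val) :
    (∃ p, v = .ch 0 p) ∨ ∃ u : Val, v = u.shiftChan := by
  cases v with
  | ch κ p =>
    cases κ with
    | zero => exact .inl ⟨p, rfl⟩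
    | succ κ => exact .inr ⟨.ch κ p, rfl⟩
  | nm a => exact .inr ⟨.nm a, rfl⟩
  | var a => exact .inr ⟨.var a, rfl⟩
  | int a => exact .inr ⟨.int a, rfl⟩
  | bool a => exact .inr ⟨.bool a, rfl⟩

theorem Val.var_ne_shiftVar {n i : ℕ} (h : i < n) (u : Val) : Val.var i ≠ u.shiftVar n := by
  cases u <;> simp [Val.shiftVar, Val.subst]; omega

theorem Val.ch_zero_ne_shiftChan (p : Pol) (u : Val) : Val.ch 0 p ≠ u.shiftChan := by
  cases u <;> simp [Val.shiftChan, Val.subst]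

theorem Asg.bindVar_ext {n : ℕ} {o : Option STy} {A B : Asg}
    (h₁ : ∀ i < n, B (.var i) = o) (h₂ : ∀ v : Val, B (v.shiftVar n) = A v) :
    B = A.bindVar n o := by
  funext v
  rcases Val.bound_or_shiftVar n v with ⟨i, hi, rfl⟩ | ⟨u, rfl⟩
  · rw [h₁ i hi, Asg.bindVar_var hi]
  · rw [h₂, Asg.bindVar_shiftVar]

theorem Asg.bindChan_ext {o : Option STy} {A B : Asg}
    (h₁ : B (.ch 0 .neg) = o) (h₂ : B (.ch 0 .pos) = o.map STy.dual)
    (h₃ : ∀ v : Val, B v.shiftChan = A v) : B = A.bindChan o := by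
  funext v
  rcases Val.bound_or_shiftChan v with ⟨p, rfl⟩ | ⟨u, rfl⟩
  · cases p <;> simp [*]
  · simp [h₃]

@[simp] theorem Asg.bindChan_empty : Asg.empty.bindChan none = Asg.empty :=
  (Asg.bindChan_ext (B := Asg.empty) rfl rfl (fun _ => rfl)).symm

@[simp] theorem Asg.empty_apply (k : Val) : Asg.empty k = none := rfl

theorem Asg.eq_empty {A : Asg} (h : ∀ k, A k = none) : A = Asg.empty := funext h

theorem Asg.bindChan_eq_empty {A : Asg} {o : Option STy} :
    A.bindChan o = Asg.empty ↔ A = Asg.empty ∧ o = none := by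
  constructor
  · intro h
    exact ⟨funext fun v => by rw [← Asg.bindChan_shiftChan o A, h]; rfl, by
      rw [← Asg.bindChan_neg o A, h]; rfl⟩
  · rintro ⟨rfl, rfl⟩; simp

/-! Disjoint unions. -/

theorem Split.symm {A B C : Asg} (h : Split A B C) : Split A C B := fun k => (h k).symm

theorem Split.empty_right (A : Asg) : Split A A Asg.empty := fun _ => .inl ⟨rfl, rfl⟩

theorem split_empty_right {A B : Asg} : Split A B Asg.empty ↔ A = B := by
  constructor
  · intro h; funext k; have := h k; grind [Asg.empty]
  · rintro rfl; exact .empty_right A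

/-- The union of `B` and `C`, with preference for `B`. -/
def Asg.join (B C : Asg) : Asg := fun k => (B k).or (C k)

theorem split_join {B C : Asg} (h : ∀ k, B k = none ∨ C k = none) : Split (B.join C) B C := by
  intro k
  rcases h k with h | h
  · right; simp [Asg.join, h]
  · left; simp [Asg.join, h]

theorem Split.assoc {A B C B₁ B₂ : Asg} (h : Split A B C) (hB : Split B B₁ B₂) :
    Split A B₁ (B₂.join C) ∧ Split (B₂.join C) B₂ C := by
  constructor
  · intro k; have := h k; have := hB k; simp only [Asg.join]; grind
  · apply split_join; intro k; have := h k; have := hB k; grind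

theorem Split.assoc_left {A B C C₁ C₂ : Asg} (h : Split A B C) (hC : Split C C₁ C₂) :
    Split A (B.join C₁) C₂ ∧ Split (B.join C₁) B C₁ := by
  constructor
  · intro k; have := h k; have := hC k; simp only [Asg.join]; grind
  · apply split_join; intro k; have := h k; have := hC k; grind

/-- The typing side of scope extrusion: both endpoints of the new channel go to the left component.
-/
theorem Split.bindChan {A B C : Asg} (h : Split A B C) (o : Option STy) :
    Split (A.bindChan o) (B.bindChan o) (C.bindChan none) := by
  intro k
  rcases Val.bound_or_shiftChan k with ⟨p, rfl⟩ | ⟨u, rfl⟩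
  · cases p <;> simp
  · simpa using h u

/-! Weakening. -/

/-- The additional pairs are passed down until they reach a leaf, where only the parity of the count
is prescribed, or a location, whose slack absorbs them without a change of the annotation. At a
parallel composition the left component takes them. -/
theorem WT.weak {Γ : Env} {P : Proc} {A : Asg} {n : ℕ} (h : WT Γ P A n) (j : ℕ) :
    WT Γ P A (n + 2 * j) := by
  induction P generalizing Γ A n with
  | nil => exact ⟨h.1, h.2.add (even_two_mul j)⟩
  | pvar X => exact ⟨h.1, h.2.add (even_two_mul j)⟩
  | adapt l P ih => exact ⟨h.1, h.2.1.add (even_two_mul j), h.2.2⟩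
  | repAccept a P ih => exact ⟨h.1, h.2.1.add (even_two_mul j), h.2.2⟩
  | accept a P ih =>
    obtain ⟨b, α, q, h₁, h₂, h₃⟩ := h
    exact ⟨b, α, q, h₁, h₂, by rw [add_right_comm]; exact ih h₃⟩
  | request a P ih =>
    obtain ⟨b, α, q, h₁, h₂, h₃⟩ := h
    exact ⟨b, α, q, h₁, h₂, by rw [add_right_comm]; exact ih h₃⟩
  | loc l z P ih =>
    obtain ⟨m, i, h₁, rfl, h₃⟩ := h
    exact ⟨m, i + j, h₁, by ring, h₃⟩
  | out k es P ih =>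
    obtain ⟨τs, α, h₁, h₂, h₃⟩ := h
    exact ⟨τs, α, h₁, h₂, ih h₃⟩
  | inp k m P ih =>
    obtain ⟨τs, α, h₁, h₂, h₃⟩ := h
    exact ⟨τs, α, h₁, h₂, ih h₃⟩
  | throwS k k' P ih =>
    obtain ⟨α, β, m, rfl, h₂, h₃, h₄, h₅⟩ := h
    exact ⟨α, β, m + 2 * j, by ring, h₂, h₃, h₄, ih h₅⟩
  | catchS k P ih =>
    obtain ⟨α, β, h₁, h₂⟩ := h
    exact ⟨α, β, h₁, by rw [add_right_comm]; exact ih h₂⟩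
  | branch k L P ih =>
    obtain ⟨h₀, α, h₁, h₂⟩ := h
    exact ⟨h₀, α, h₁, fun i => ih i (h₂ i)⟩
  | select k i P ih =>
    obtain ⟨L, α, hi, h₁, h₂⟩ := h
    exact ⟨L, α, hi, h₁, ih h₂⟩
  | par P Q ihP ihQ =>
    obtain ⟨B, C, m, i, rfl, h₁, h₂, h₃⟩ := h
    exact ⟨B, C, m + 2 * j, i, by ring, h₁, ihP h₂, h₃⟩
  | ite e P Q ihP ihQ => exact ⟨h.1, ihP h.2.1, ihQ h.2.2⟩
  | close k P ih =>
    obtain ⟨m, rfl, h₁, h₂⟩ := h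
    exact ⟨m + 2 * j, by ring, h₁, ih h₂⟩
  | res P ih =>
    obtain ⟨o, h⟩ := h
    exact ⟨o, ih h⟩

theorem WT.of_even {Γ : Env} {P : Proc} {A : Asg} {n m : ℕ} (h : WT Γ P A n) (hm : Even m) :
    WT Γ P A (n + m) := by
  obtain ⟨j, rfl⟩ := hm
  rw [← two_mul]
  exact h.weak j

/-! The number of assignments bounds the number of keys. -/

/-- At most `n` keys are assigned a type. -/
def Asg.CardLE (A : Asg) (n : ℕ) : Prop :=
  ∀ S : Finset Val, (∀ k ∈ S, A k ≠ none) → S.card ≤ n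

theorem Asg.cardLE_empty (n : ℕ) : Asg.empty.CardLE n := by
  intro S hS
  rw [Finset.eq_empty_of_forall_notMem (s := S) fun k hk => hS k hk rfl]
  simp

theorem Asg.CardLE.eq_empty {A : Asg} (h : A.CardLE 0) : A = Asg.empty := by
  refine Asg.eq_empty fun k => ?_
  by_contra hk
  simpa using h {k} (by simpa using hk)

theorem Asg.CardLE.of_update_some {A : Asg} {k : Val} {α : STy} {n : ℕ}
    (h : Asg.CardLE (Function.update A k (some α)) n) : A.CardLE n := by
  refine fun S hS => h S fun i hi => ?_
  rcases eq_or_ne i k with rfl | hne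
  · simp
  · rw [Function.update_of_ne hne]; exact hS i hi

theorem Asg.CardLE.of_update_none {A : Asg} {k : Val} {n : ℕ}
    (h : Asg.CardLE (Function.update A k none) n) : A.CardLE (n + 1) := by
  intro S hS
  have := h (S.erase k) fun i hi => by
    rw [Function.update_of_ne (Finset.ne_of_mem_erase hi)]
    exact hS i (Finset.mem_of_mem_erase hi)
  have := Finset.pred_card_le_card_erase (s := S) (a := k)
  omega

theorem Asg.CardLE.of_bindVar {A : Asg} {m n : ℕ} {o : Option STy}
    (h : (A.bindVar m o).CardLE n) : A.CardLE n := by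
  intro S hS
  rw [← Finset.card_map ⟨_, Val.shiftVar_injective m⟩]
  refine h _ fun i hi => ?_
  obtain ⟨k, hk, rfl⟩ := Finset.mem_map.1 hi
  simpa using hS k hk

theorem Asg.CardLE.of_bindVar_some {A : Asg} {n : ℕ} {α : STy}
    (h : (A.bindVar 1 (some α)).CardLE (n + 1)) : A.CardLE n := by
  intro S hS
  have := h (insert (.var 0) (S.map ⟨_, Val.shiftVar_injective 1⟩)) ?_
  · rw [Finset.card_insert_of_notMem, Finset.card_map] at this
    · omega
    · intro h
      obtain ⟨k, -, hk⟩ := Finset.mem_map.1 h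
      exact Val.var_ne_shiftVar one_pos k hk.symm
  · intro i hi
    rcases Finset.mem_insert.1 hi with rfl | hi
    · simp [Asg.bindVar]
    · obtain ⟨k, hk, rfl⟩ := Finset.mem_map.1 hi
      simpa using hS k hk

theorem Asg.CardLE.of_bindChan {A : Asg} {n : ℕ} {o : Option STy}
    (h : (A.bindChan o).CardLE n) : A.CardLE n := by
  intro S hS
  rw [← Finset.card_map ⟨_, Val.shiftChan_injective⟩]
  refine h _ fun i hi => ?_
  obtain ⟨k, hk, rfl⟩ := Finset.mem_map.1 hi
  simpa using hS k hk

theorem Split.cardLE {A B C : Asg} {m n : ℕ} (h : Split A B C) (hB : B.CardLE m)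
    (hC : C.CardLE n) : A.CardLE (m + n) := by
  intro S hS
  have h₁ := hB (S.filter fun k => B k ≠ none) (by simp)
  have h₂ := hC (S.filter fun k => ¬ B k ≠ none) (by
    intro k hk
    rw [Finset.mem_filter] at hk
    have := h k
    have := hS k hk.1
    grind)
  have := Finset.card_filter_add_card_filter_not (s := S) fun k => B k ≠ none
  omega

/-- Leaves have no keys, and each construct that adds or consumes a key changes the count along with
it. The case of interest is count zero: a process under an annotation `0` has no key at all. -/
theorem WT.cardLE {Γ : Env} {P : Proc} {A : Asg} {n : ℕ} (h : WT Γ P A n) : A.CardLE n := by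
  induction P generalizing Γ A n with
  | nil => obtain ⟨rfl, -⟩ := h; exact Asg.cardLE_empty n
  | pvar X => obtain ⟨rfl, -⟩ := h; exact Asg.cardLE_empty n
  | adapt l P ih => obtain ⟨rfl, -⟩ := h; exact Asg.cardLE_empty n
  | repAccept a P ih => obtain ⟨rfl, -⟩ := h; exact Asg.cardLE_empty n
  | accept a P ih =>
    obtain ⟨b, α, q, h₁, h₂, h₃⟩ := h
    exact (ih h₃).of_bindVar_some
  | request a P ih =>
    obtain ⟨b, α, q, h₁, h₂, h₃⟩ := h
    exact (ih h₃).of_bindVar_some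
  | loc l z P ih =>
    obtain ⟨m, i, h₁, rfl, h₃⟩ := h
    exact fun S hS => (ih h₃ S hS).trans (by omega)
  | out k es P ih =>
    obtain ⟨τs, α, h₁, h₂, h₃⟩ := h
    exact (ih h₃).of_update_some
  | inp k m P ih =>
    obtain ⟨τs, α, h₁, h₂, h₃⟩ := h
    exact (ih h₃).of_bindVar.of_update_some
  | throwS k k' P ih =>
    obtain ⟨α, β, m, rfl, h₂, h₃, h₄, h₅⟩ := h
    exact (ih h₅).of_update_none.of_update_some
  | catchS k P ih =>
    obtain ⟨α, β, h₁, h₂⟩ := h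
    exact (ih h₂).of_bindVar_some.of_update_some
  | branch k L P ih =>
    -- One branch bounds the assignment. An empty branching would put no condition on the other
    -- keys, which is why labels must exist.
    obtain ⟨⟨i, hi⟩, α, h₁, h₂⟩ := h
    exact (ih ⟨i, hi⟩ (h₂ ⟨i, hi⟩)).of_update_some
  | select k i P ih =>
    obtain ⟨L, α, hi, h₁, h₂⟩ := h
    exact (ih h₂).of_update_some
  | par P Q ihP ihQ =>
    obtain ⟨B, C, m, i, rfl, h₁, h₂, h₃⟩ := h
    exact h₁.cardLE (ihP h₂) (ihQ h₃)
  | ite e P Q ihP ihQ => exact ihP h.2.1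
  | close k P ih =>
    obtain ⟨m, rfl, h₁, h₂⟩ := h
    exact (ih h₂).of_update_none
  | res P ih =>
    obtain ⟨o, h⟩ := h
    exact (ih h).of_bindChan

/-! Substitution. -/

/-- `f` maps the keys of `A` injectively onto those of `A'`. -/
structure KeyMap (f : Val → Val) (A A' : Asg) : Prop where
  map : ∀ v, A v ≠ none → A' (f v) = A v
  surj : ∀ w, A' w ≠ none → ∃ v, A v ≠ none ∧ f v = w
  inj : ∀ v w, A v ≠ none → A w ≠ none → f v = f w → v = w

theorem KeyMap.empty (f : Val → Val) : KeyMap f Asg.empty Asg.empty :=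
  ⟨fun _ h => (h rfl).elim, fun _ h => (h rfl).elim, fun _ _ h => (h rfl).elim⟩

theorem KeyMap.eq_empty {f : Val → Val} {A' : Asg} (h : KeyMap f Asg.empty A') :
    A' = Asg.empty := by
  refine Asg.eq_empty fun w => ?_
  by_contra hw
  obtain ⟨v, hv, -⟩ := h.surj w hw
  exact hv rfl

/-- Since `k` itself is assigned, injectivity ensures that no other assigned key is mapped to `f k`,
so that overwriting there affects nothing else. -/
theorem KeyMap.update {f : Val → Val} {A A' : Asg} (h : KeyMap f A A') {k : Val}
    (hk : A k ≠ none) (o : Option STy) :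
    KeyMap f (Function.update A k o) (Function.update A' (f k) o) := by
  refine ⟨fun v hv => ?_, fun w hw => ?_, fun v w hv hw hvw => ?_⟩
  · rcases eq_or_ne v k with rfl | hne
    · simp
    · rw [Function.update_of_ne hne] at hv ⊢
      rw [Function.update_of_ne fun he => hne (h.inj _ _ hv hk he)]
      exact h.map v hv
  · rcases eq_or_ne w (f k) with rfl | hne
    · exact ⟨k, by simpa using hw, rfl⟩
    · rw [Function.update_of_ne hne] at hw
      obtain ⟨v, hv, rfl⟩ := h.surj w hw
      exact ⟨v, by rwa [Function.update_of_ne fun he => hne (by rw [he])], rfl⟩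
  · refine h.inj v w ?_ ?_ hvw
    · rcases eq_or_ne v k with rfl | hne
      · exact hk
      · rwa [Function.update_of_ne hne] at hv
    · rcases eq_or_ne w k with rfl | hne
      · exact hk
      · rwa [Function.update_of_ne hne] at hw

/-- Passage below a binder: `lift` embeds the values outside, and `b` singles out the values
that are bound. -/
theorem KeyMap.lift {f f' : Val → Val} {A A' B B' : Asg} (h : KeyMap f A A')
    (lift : Val → Val) (b : Val → Prop) (cover : ∀ v, b v ∨ ∃ u, v = lift u)
    (disj : ∀ v, b v → ∀ u, v ≠ lift u) (inj : Function.Injective lift)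
    (fb : ∀ v, b v → f' v = v) (fl : ∀ u, f' (lift u) = lift (f u))
    (hb : ∀ v, b v → B' v = B v) (hB : ∀ u, B (lift u) = A u) (hB' : ∀ u, B' (lift u) = A' u) :
    KeyMap f' B B' := by
  refine ⟨fun v hv => ?_, fun w hw => ?_, fun v w hv hw hvw => ?_⟩
  · rcases cover v with hv' | ⟨u, rfl⟩
    · rw [fb v hv', hb v hv']
    · rw [fl, hB', hB]; rw [hB] at hv; exact h.map u hv
  · rcases cover w with hw' | ⟨u, rfl⟩
    · exact ⟨w, by rwa [← hb w hw'], fb w hw'⟩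
    · rw [hB'] at hw
      obtain ⟨v, hv, rfl⟩ := h.surj u hw
      exact ⟨lift v, by rwa [hB], fl v⟩
  · rcases cover v with hv' | ⟨u, rfl⟩ <;> rcases cover w with hw' | ⟨u', rfl⟩
    · rwa [fb v hv', fb w hw'] at hvw
    · rw [fb v hv', fl] at hvw; exact (disj v hv' _ hvw).elim
    · rw [fb w hw', fl] at hvw; exact (disj w hw' _ hvw.symm).elim
    · rw [fl, fl] at hvw
      rw [hB] at hv hw
      rw [h.inj u u' hv hw (inj hvw)]

theorem Val.subst_liftVar_shiftVar (σ : ℕ → Val) (ρ : ℕ → ℕ) (n : ℕ) (v : Val) :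
    (v.shiftVar n).subst (liftVar n σ) ρ = (v.subst σ ρ).shiftVar n := by
  cases v <;> simp [Val.shiftVar, Val.subst, liftVar]

theorem Val.subst_liftRen_shiftChan (σ : ℕ → Val) (ρ : ℕ → ℕ) (v : Val) :
    v.shiftChan.subst (fun i => (σ i).shiftChan) (liftRen ρ) = (v.subst σ ρ).shiftChan := by
  cases v <;> simp [Val.shiftChan, Val.subst, liftRen]

theorem KeyMap.bindVar {σ : ℕ → Val} {ρ : ℕ → ℕ} {A A' : Asg}
    (h : KeyMap (Val.subst σ ρ) A A') (n : ℕ) (o : Option STy) :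
    KeyMap (Val.subst (liftVar n σ) ρ) (A.bindVar n o) (A'.bindVar n o) := by
  refine h.lift (Val.shiftVar n) (fun v => ∃ i < n, v = .var i) (Val.bound_or_shiftVar n)
    ?_ (Val.shiftVar_injective n) ?_ (Val.subst_liftVar_shiftVar σ ρ n) ?_
    (Asg.bindVar_shiftVar n o A) (Asg.bindVar_shiftVar n o A')
  · rintro _ ⟨i, hi, rfl⟩ u; exact Val.var_ne_shiftVar hi u
  · rintro _ ⟨i, hi, rfl⟩; simp [Val.subst, liftVar, hi]
  · rintro _ ⟨i, hi, rfl⟩; rw [Asg.bindVar_var hi, Asg.bindVar_var hi]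

theorem KeyMap.bindChan {σ : ℕ → Val} {ρ : ℕ → ℕ} {A A' : Asg}
    (h : KeyMap (Val.subst σ ρ) A A') (o : Option STy) :
    KeyMap (Val.subst (fun i => (σ i).shiftChan) (liftRen ρ)) (A.bindChan o)
      (A'.bindChan o) := by
  refine h.lift Val.shiftChan (fun v => ∃ p, v = .ch 0 p) Val.bound_or_shiftChan
    ?_ Val.shiftChan_injective ?_ (Val.subst_liftRen_shiftChan σ ρ) ?_
    (Asg.bindChan_shiftChan o A) (Asg.bindChan_shiftChan o A')
  · rintro _ ⟨p, rfl⟩ u; exact Val.ch_zero_ne_shiftChan p u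
  · rintro _ ⟨p, rfl⟩; rfl
  · rintro _ ⟨p, rfl⟩; cases p <;> simp

/-- The parts of `A'` are its restrictions to the images of the keys of `B` and of `C`; these images
are disjoint because `f` is injective on the keys of `A`. -/
theorem KeyMap.split {f : Val → Val} {A A' B C : Asg} (h : KeyMap f A A') (hs : Split A B C) :
    ∃ B' C', Split A' B' C' ∧ KeyMap f B B' ∧ KeyMap f C C' := by
  classical
  have hB : ∀ v, B v ≠ none → A v = B v := fun v hv => by have := hs v; grind
  have hC : ∀ v, C v ≠ none → A v = C v := fun v hv => by have := hs v; grind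
  refine ⟨fun w => if ∃ v, B v ≠ none ∧ f v = w then A' w else none,
    fun w => if ∃ v, C v ≠ none ∧ f v = w then A' w else none, ?_, ?_, ?_⟩
  · intro w
    by_cases hw : A' w = none
    · simp [hw]
    · beta_reduce
      obtain ⟨v, hv, rfl⟩ := h.surj w hw
      have key : ∀ u, A u ≠ none → f u = f v → u = v := fun u hu e => h.inj u v hu hv e
      rcases hs v with ⟨h₁, h₂⟩ | ⟨h₁, h₂⟩
      · left
        rw [if_pos ⟨v, by rwa [← h₁], rfl⟩, if_neg]
        · exact ⟨rfl, rfl⟩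
        · rintro ⟨u, hu, e⟩
          have := key u (by rwa [hC u hu]) e
          subst this; exact hu h₂
      · right
        rw [if_pos ⟨v, by rwa [← h₁], rfl⟩, if_neg]
        · exact ⟨rfl, rfl⟩
        · rintro ⟨u, hu, e⟩
          have := key u (by rwa [hB u hu]) e
          subst this; exact hu h₂
  · refine ⟨fun v hv => ?_, fun w hw => ?_, fun v w hv hw e => ?_⟩
    · rw [if_pos ⟨v, hv, rfl⟩, h.map v (by rwa [hB v hv]), hB v hv]
    · by_contra hn; rw [if_neg hn] at hw; exact hw rfl
    · exact h.inj v w (by rwa [hB v hv]) (by rwa [hB w hw]) e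
  · refine ⟨fun v hv => ?_, fun w hw => ?_, fun v w hv hw e => ?_⟩
    · rw [if_pos ⟨v, hv, rfl⟩, h.map v (by rwa [hC v hv]), hC v hv]
    · by_contra hn; rw [if_neg hn] at hw; exact hw rfl
    · exact h.inj v w (by rwa [hC v hv]) (by rwa [hC w hw]) e

/-- `σ` respects the types of the variables that have a basic type. -/
structure EnvMap (σ : ℕ → Val) (Γ Γ' : Env) : Prop where
  name : Γ'.name = Γ.name
  var : ∀ i τ, Γ.var i = some τ → ExprTyped Γ' (.val (σ i)) τ

theorem ExprTyped.shiftVar {Γ Γ' : Env} {v : Val} {τ : BTy} (n : ℕ)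
    (hn : Γ'.name = Γ.name) (hv : ∀ i, Γ'.var (i + n) = Γ.var i)
    (h : ExprTyped Γ (.val v) τ) : ExprTyped Γ' (.val (v.shiftVar n)) τ := by
  cases h with
  | int => exact .int _
  | bool => exact .bool _
  | nm h => exact .nm (by rwa [hn])
  | var h => exact .var (by rwa [hv])

theorem Env.bindVals_add (Γ : Env) (τs : List BTy) (i : ℕ) :
    (Γ.bindVals τs).var (i + τs.length) = Γ.var i := by
  simp [Env.bindVals]

theorem EnvMap.bindVals {σ : ℕ → Val} {Γ Γ' : Env} (h : EnvMap σ Γ Γ') (τs : List BTy) :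
    EnvMap (liftVar τs.length σ) (Γ.bindVals τs) (Γ'.bindVals τs) := by
  refine ⟨h.name, fun i τ hi => ?_⟩
  by_cases hlt : i < τs.length
  · simp only [liftVar, if_pos hlt]
    refine .var ?_
    simpa [Env.bindVals, hlt] using hi
  · simp only [liftVar, if_neg hlt]
    simp only [Env.bindVals, if_neg hlt] at hi
    exact ExprTyped.shiftVar (Γ := Γ') _ rfl (Env.bindVals_add Γ' τs) (h.var _ _ hi)

theorem EnvMap.bindSess {σ : ℕ → Val} {Γ Γ' : Env} (h : EnvMap σ Γ Γ') :
    EnvMap (liftVar 1 σ) Γ.bindSess Γ'.bindSess := by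
  refine ⟨h.name, fun i τ hi => ?_⟩
  cases i with
  | zero => simp [Env.bindSess] at hi
  | succ i => exact ExprTyped.shiftVar (Γ := Γ') 1 rfl (fun _ => rfl) (h.var i τ hi)

theorem EnvMap.bindChan {σ : ℕ → Val} {Γ Γ' : Env} (h : EnvMap σ Γ Γ') :
    EnvMap (fun i => (σ i).shiftChan) Γ Γ' := by
  refine ⟨h.name, fun i τ hi => ?_⟩
  have := h.var i τ hi
  generalize σ i = v at this
  cases this with
  | int => exact .int _
  | bool => exact .bool _
  | nm h => exact .nm h
  | var h => exact .var h

theorem ExprTyped.subst {σ : ℕ → Val} {Γ Γ' : Env} (hΓ : EnvMap σ Γ Γ') (ρ : ℕ → ℕ) {e : Expr}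
    {τ : BTy} (h : ExprTyped Γ e τ) : ExprTyped Γ' (e.subst σ ρ) τ := by
  induction h with
  | int z => exact .int z
  | bool b => exact .bool b
  | nm h => exact .nm (by rwa [hΓ.name])
  | var h => exact hΓ.var _ _ h
  | add _ _ h₁ h₂ => exact .add h₁ h₂
  | sub _ _ h₁ h₂ => exact .sub h₁ h₂
  | eq _ _ h₁ h₂ => exact .eq h₁ h₂
  | le _ _ h₁ h₂ => exact .le h₁ h₂
  | and _ _ h₁ h₂ => exact .and h₁ h₂
  | not _ h => exact .not h

/-- Only the values of assigned keys are constrained. Injectivity on them keeps distinct endpoints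
distinct, and surjectivity ensures that an empty assignment stays empty at the leaves. Channel
renamings, shifts and the instantiation of bound names are all instances. -/
theorem WT.subst {Γ Γ' : Env} {σ : ℕ → Val} {ρ : ℕ → ℕ} {P : Proc} {A A' : Asg} {n : ℕ}
    (h : WT Γ P A n) (hΓ : EnvMap σ Γ Γ') (hA : KeyMap (Val.subst σ ρ) A A') :
    WT Γ' (P.subst σ ρ) A' n := by
  have map : ∀ {σ : ℕ → Val} {ρ : ℕ → ℕ} {A A' : Asg} {k : Val} {α : STy},
      KeyMap (Val.subst σ ρ) A A' → A k = some α →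
      A k ≠ none ∧ A' (k.subst σ ρ) = some α := by
    intro σ ρ A A' k α hA hk
    have : A k ≠ none := by simp [hk]
    exact ⟨this, by rw [hA.map k this, hk]⟩
  induction P generalizing Γ Γ' σ ρ A A' n with
  | nil => obtain ⟨rfl, h⟩ := h; exact ⟨hA.eq_empty, h⟩
  | pvar X => obtain ⟨rfl, h⟩ := h; exact ⟨hA.eq_empty, h⟩
  | adapt l P ih =>
    obtain ⟨rfl, h, hP⟩ := h; exact ⟨hA.eq_empty, h, ih hP hΓ (KeyMap.empty _)⟩
  | repAccept a P ih =>
    obtain ⟨rfl, h₀, b, α, q, rfl, h₂, h₃⟩ := h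
    exact ⟨hA.eq_empty, h₀, b, α, q, rfl, by rwa [hΓ.name],
      ih h₃ hΓ.bindSess ((KeyMap.empty _).bindVar 1 (some α))⟩
  | accept a P ih =>
    obtain ⟨b, α, q, rfl, h₂, h₃⟩ := h
    exact ⟨b, α, q, rfl, by rwa [hΓ.name], ih h₃ hΓ.bindSess (hA.bindVar 1 _)⟩
  | request a P ih =>
    obtain ⟨b, α, q, rfl, h₂, h₃⟩ := h
    exact ⟨b, α, q, rfl, by rwa [hΓ.name], ih h₃ hΓ.bindSess (hA.bindVar 1 _)⟩
  | loc l z P ih =>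
    obtain ⟨m, i, h₁, rfl, h₃⟩ := h
    exact ⟨m, i, h₁, rfl, ih h₃ hΓ hA⟩
  | out k es P ih =>
    obtain ⟨τs, α, h₁, h₂, h₃⟩ := h
    obtain ⟨hk, hk'⟩ := map hA h₂
    refine ⟨τs, α, ?_, hk', ih h₃ hΓ (hA.update hk _)⟩
    rw [List.forall₂_map_left_iff]
    exact h₁.imp fun _ _ h => h.subst hΓ ρ
  | inp k m P ih =>
    obtain ⟨τs, α, rfl, h₂, h₃⟩ := h
    obtain ⟨hk, hk'⟩ := map hA h₂
    exact ⟨τs, α, rfl, hk', ih h₃ (hΓ.bindVals τs) ((hA.update hk _).bindVar _ none)⟩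
  | throwS k k' P ih =>
    obtain ⟨α, β, m, rfl, h₂, h₃, h₄, h₅⟩ := h
    obtain ⟨hk, hkA⟩ := map hA h₃
    obtain ⟨hk', hkA'⟩ := map hA h₄
    refine ⟨α, β, m, rfl, fun he => h₂ (hA.inj _ _ hk hk' he), hkA, hkA',
      ih h₅ hΓ ((hA.update hk _).update ?_ _)⟩
    rwa [Function.update_of_ne h₂.symm]
  | catchS k P ih =>
    obtain ⟨α, β, h₂, h₃⟩ := h
    obtain ⟨hk, hk'⟩ := map hA h₂
    exact ⟨α, β, hk', ih h₃ hΓ.bindSess ((hA.update hk _).bindVar 1 _)⟩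
  | branch k L P ih =>
    obtain ⟨hL, α, h₂, h₃⟩ := h
    obtain ⟨hk, hk'⟩ := map hA h₂
    exact ⟨hL, α, hk', fun i => ih i (h₃ i) hΓ (hA.update hk _)⟩
  | select k i P ih =>
    obtain ⟨L, α, hi, h₂, h₃⟩ := h
    obtain ⟨hk, hk'⟩ := map hA h₂
    exact ⟨L, α, hi, hk', ih h₃ hΓ (hA.update hk _)⟩
  | par P Q ihP ihQ =>
    obtain ⟨B, C, m, i, rfl, h₁, h₂, h₃⟩ := h
    obtain ⟨B', C', hs, hB, hC⟩ := hA.split h₁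
    exact ⟨B', C', m, i, rfl, hs, ihP h₂ hΓ hB, ihQ h₃ hΓ hC⟩
  | ite e P Q ihP ihQ => exact ⟨h.1.subst hΓ ρ, ihP h.2.1 hΓ hA, ihQ h.2.2 hΓ hA⟩
  | close k P ih =>
    obtain ⟨m, rfl, h₂, h₃⟩ := h
    obtain ⟨hk, hk'⟩ := map hA h₂
    exact ⟨m, rfl, hk', ih h₃ hΓ (hA.update hk _)⟩
  | res P ih =>
    obtain ⟨o, h⟩ := h
    exact ⟨o, ih h hΓ.bindChan (hA.bindChan o)⟩

/-! Renaming of channels. -/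

@[simp] theorem liftVar_var (n : ℕ) : liftVar n Val.var = Val.var := by
  funext i
  simp only [liftVar, Val.shiftVar, Val.subst]
  split
  · rfl
  · rw [Nat.sub_add_cancel (by omega)]

theorem EnvMap.var_self (Γ : Env) : EnvMap Val.var Γ Γ := ⟨rfl, fun _ _ h => .var h⟩

theorem liftRen_comp (ρ ρ' : ℕ → ℕ) : liftRen ρ ∘ liftRen ρ' = liftRen (ρ ∘ ρ') := by
  funext i; cases i <;> rfl

theorem Val.subst_var_subst (ρ ρ' : ℕ → ℕ) (v : Val) :
    (v.subst .var ρ').subst .var ρ = v.subst .var (ρ ∘ ρ') := by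
  cases v <;> rfl

theorem Expr.subst_var_subst (ρ ρ' : ℕ → ℕ) (e : Expr) :
    (e.subst .var ρ').subst .var ρ = e.subst .var (ρ ∘ ρ') := by
  induction e <;> simp [Expr.subst, Val.subst_var_subst, *]

theorem Proc.renChan_renChan (ρ ρ' : ℕ → ℕ) (P : Proc) :
    (P.renChan ρ').renChan ρ = P.renChan (ρ ∘ ρ') := by
  have hs : (fun i => (Val.var i).shiftChan) = Val.var := rfl
  unfold Proc.renChan
  induction P generalizing ρ ρ' <;>
    simp_all [Proc.subst, Val.subst_var_subst, liftRen_comp, Expr.subst_var_subst]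

@[simp] theorem liftRen_id : liftRen id = id := by funext i; cases i <;> rfl

theorem Val.subst_var_id (v : Val) : v.subst .var id = v := by cases v <;> rfl

theorem Expr.subst_var_id (e : Expr) : e.subst .var id = e := by
  induction e <;> simp [Expr.subst, Val.subst_var_id, *]

theorem Proc.renChan_id (P : Proc) : P.renChan id = P := by
  have hs : (fun i => (Val.var i).shiftChan) = Val.var := rfl
  have he : Expr.subst .var id = id := funext Expr.subst_var_id
  unfold Proc.renChan
  induction P <;> simp_all [Proc.subst, Val.subst_var_id]

/-- By linearity an assigned key has to be consumed on the way to the leaves, where the assignment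
is empty. Only prefixes consume keys, and in the renamed process no key of theirs is an endpoint of
a channel outside the range of `ρ`. -/
theorem WT.eq_none_of_renChan {Γ : Env} {P : Proc} {ρ : ℕ → ℕ} {A : Asg} {n : ℕ}
    (h : WT Γ (P.renChan ρ) A n) {κ : ℕ} (hκ : ∀ i, ρ i ≠ κ) (p : Pol) :
    A (.ch κ p) = none := by
  have ne : ∀ {ρ : ℕ → ℕ} {κ : ℕ}, (∀ i, ρ i ≠ κ) → ∀ k : Val,
      Val.ch κ p ≠ k.subst .var ρ := by
    intro ρ κ hκ k
    cases k <;> simp [Val.subst]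
    exact fun h => (hκ _ h.symm).elim
  unfold Proc.renChan at h
  induction P generalizing Γ ρ A n κ with
  | nil => rw [h.1]; rfl
  | pvar X => rw [h.1]; rfl
  | adapt l P ih => rw [h.1]; rfl
  | repAccept a P ih => rw [h.1]; rfl
  | accept a P ih =>
    obtain ⟨b, α, q, h₁, h₂, h₃⟩ := h
    rw [liftVar_var] at h₃
    exact ih h₃ hκ
  | request a P ih =>
    obtain ⟨b, α, q, h₁, h₂, h₃⟩ := h
    rw [liftVar_var] at h₃
    exact ih h₃ hκ
  | loc l z P ih =>
    obtain ⟨m, i, h₁, rfl, h₃⟩ := h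
    exact ih h₃ hκ
  | out k es P ih =>
    obtain ⟨τs, α, h₁, h₂, h₃⟩ := h
    have := ih h₃ hκ
    rwa [Function.update_of_ne (ne hκ k)] at this
  | inp k m P ih =>
    obtain ⟨τs, α, h₁, h₂, h₃⟩ := h
    rw [liftVar_var] at h₃
    have := ih h₃ hκ
    rwa [Asg.bindVar_ch, Function.update_of_ne (ne hκ k)] at this
  | throwS k k' P ih =>
    obtain ⟨α, β, m, rfl, h₂, h₃, h₄, h₅⟩ := h
    have := ih h₅ hκ
    rwa [Function.update_of_ne (ne hκ k'), Function.update_of_ne (ne hκ k)] at this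
  | catchS k P ih =>
    obtain ⟨α, β, h₂, h₃⟩ := h
    rw [liftVar_var] at h₃
    have := ih h₃ hκ
    rwa [Asg.bindVar_ch, Function.update_of_ne (ne hκ k)] at this
  | branch k L P ih =>
    obtain ⟨⟨i, hi⟩, α, h₂, h₃⟩ := h
    have := ih ⟨i, hi⟩ (h₃ ⟨i, hi⟩) hκ
    rwa [Function.update_of_ne (ne hκ k)] at this
  | select k i P ih =>
    obtain ⟨L, α, hi, h₂, h₃⟩ := h
    have := ih h₃ hκ
    rwa [Function.update_of_ne (ne hκ k)] at this
  | par P Q ihP ihQ =>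
    obtain ⟨B, C, m, i, rfl, h₁, h₂, h₃⟩ := h
    have := ihP h₂ hκ
    have := ihQ h₃ hκ
    have := h₁ (.ch κ p)
    grind
  | ite e P Q ihP ihQ => exact ihP h.2.1 hκ
  | close k P ih =>
    obtain ⟨m, rfl, h₂, h₃⟩ := h
    have := ih h₃ hκ
    rwa [Function.update_of_ne (ne hκ k)] at this
  | res P ih =>
    obtain ⟨o, h⟩ := h
    have := ih (ρ := liftRen ρ) (κ := κ + 1) h (fun i => by cases i <;> simp [liftRen, hκ])
    simpa using this

theorem WT.shiftChan {Γ : Env} {P : Proc} {A : Asg} {n : ℕ} (h : WT Γ P A n) :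
    WT Γ P.shiftChan (A.bindChan none) n := by
  refine h.subst (EnvMap.var_self Γ) ⟨fun v _ => Asg.bindChan_shiftChan none A v, fun w hw => ?_,
    fun v w _ _ e => Val.shiftChan_injective e⟩
  rcases Val.bound_or_shiftChan w with ⟨p, rfl⟩ | ⟨u, rfl⟩
  · cases p <;> simp at hw
  · rw [Asg.bindChan_shiftChan] at hw; exact ⟨u, hw, rfl⟩

theorem WT.of_shiftChan {Γ : Env} {P : Proc} {B : Asg} {n : ℕ} (h : WT Γ P.shiftChan B n) :
    ∃ A : Asg, B = A.bindChan none ∧ WT Γ P A n := by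
  have h₀ : ∀ p, B (.ch 0 p) = none := fun p => h.eq_none_of_renChan (fun i => i.succ_ne_zero) p
  refine ⟨fun v => B v.shiftChan, Asg.bindChan_ext (h₀ _) (h₀ _) fun _ => rfl, ?_⟩
  have : (P.shiftChan).renChan Nat.pred = P := by
    rw [Proc.shiftChan, Proc.renChan_renChan]
    exact Proc.renChan_id P
  rw [← this]
  have hp : ∀ u : Val, u.shiftChan.subst .var Nat.pred = u := by intro u; cases u <;> rfl
  -- `Nat.pred` identifies the channels `0` and `1`, but it is injective on the assigned keys, as
  -- channel `0` has none.
  refine h.subst (EnvMap.var_self Γ) ⟨fun v hv => ?_, fun w hw => ⟨_, hw, hp w⟩,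
    fun v w hv hw e => ?_⟩
  · rcases Val.bound_or_shiftChan v with ⟨p, rfl⟩ | ⟨u, rfl⟩
    · exact (hv (h₀ p)).elim
    · rw [hp]
  · rcases Val.bound_or_shiftChan v with ⟨p, rfl⟩ | ⟨u, rfl⟩
    · exact (hv (h₀ p)).elim
    rcases Val.bound_or_shiftChan w with ⟨p, rfl⟩ | ⟨u', rfl⟩
    · exact (hw (h₀ p)).elim
    rw [hp, hp] at e
    rw [e]

theorem swap01_swap01 : swap01 ∘ swap01 = id := by
  funext i
  rcases i with _ | _ | i <;> rfl

theorem WT.swap {Γ : Env} {P : Proc} {A : Asg} {n : ℕ} {o o' : Option STy}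
    (h : WT Γ P ((A.bindChan o).bindChan o') n) :
    WT Γ (P.renChan swap01) ((A.bindChan o').bindChan o) n := by
  have inv : ∀ v : Val, (v.subst .var swap01).subst .var swap01 = v := fun v => by
    rw [Val.subst_var_subst, swap01_swap01, Val.subst_var_id]
  have map : ∀ v : Val, (A.bindChan o').bindChan o (v.subst .var swap01) =
      (A.bindChan o).bindChan o' v := by
    intro v
    cases v with
    | ch κ p => rcases κ with _ | _ | κ <;> cases p <;> rfl
    | _ => rfl
  refine h.subst (EnvMap.var_self Γ) ⟨fun v _ => map v, fun w hw => ⟨w.subst .var swap01, ?_, inv w⟩,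
    fun v w _ _ e => ?_⟩
  · rwa [← map, inv]
  · rw [← inv v, e, inv]

/-! Structural congruence. -/

/-- The equivalence, at a fixed assignment and count, is what the symmetry rule needs. A restriction
does not change the count, since its endpoints are still counted outside; this is why it may cross a
location without affecting the annotation. -/
theorem StrCong.wt_iff {P Q : Proc} (h : StrCong P Q) {Γ : Env} {A : Asg} {n : ℕ} :
    WT Γ P A n ↔ WT Γ Q A n := by
  induction h generalizing Γ A n with
  | refl => rfl
  | symm _ ih => exact ih.symm
  | trans _ _ ih₁ ih₂ => exact ih₁.trans ih₂
  | parComm P Q =>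
    constructor <;> rintro ⟨B, C, m, j, rfl, h, h₁, h₂⟩ <;>
      exact ⟨C, B, j, m, add_comm _ _, h.symm, h₂, h₁⟩
  | parAssoc P Q R =>
    constructor
    · rintro ⟨B, C, m, j, rfl, h, ⟨B₁, B₂, m₁, m₂, rfl, hB, h₁, h₂⟩, h₃⟩
      obtain ⟨h', h''⟩ := h.assoc hB
      exact ⟨_, _, _, _, add_assoc _ _ _, h', h₁, _, _, _, _, rfl, h'', h₂, h₃⟩
    · rintro ⟨B, C, m, j, rfl, h, h₁, ⟨C₁, C₂, m₁, m₂, rfl, hC, h₂, h₃⟩⟩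
      obtain ⟨h', h''⟩ := h.assoc_left hC
      exact ⟨_, _, _, _, (add_assoc _ _ _).symm, h', ⟨_, _, _, _, rfl, h'', h₁, h₂⟩, h₃⟩
  | parNil P =>
    constructor
    · rintro ⟨B, C, m, j, rfl, h, h₁, rfl, hj⟩
      rw [split_empty_right.1 h]
      -- The inactive process may carry an even surplus, which the other component takes over by
      -- weakening.
      exact h₁.of_even hj
    · intro h
      exact ⟨A, Asg.empty, n, 0, rfl, .empty_right A, h, rfl, .zero⟩
  | resNil =>
    constructor
    · rintro ⟨o, h, hn⟩
      exact ⟨(Asg.bindChan_eq_empty.1 h).1, hn⟩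
    · rintro ⟨rfl, hn⟩
      exact ⟨none, by simp, hn⟩
  | resSwap P =>
    constructor
    · rintro ⟨o, o', h⟩
      exact ⟨o', o, h.swap⟩
    · rintro ⟨o, o', h⟩
      refine ⟨o', o, ?_⟩
      have := h.swap
      rwa [Proc.renChan_renChan, swap01_swap01, Proc.renChan_id] at this
  | resPar P Q =>
    constructor
    · rintro ⟨B, C, m, j, rfl, h, ⟨o, h₁⟩, h₂⟩
      exact ⟨o, _, _, m, j, rfl, h.bindChan o, h₁, h₂.shiftChan⟩
    · rintro ⟨o, B, C, m, j, rfl, h, h₁, h₂⟩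
      obtain ⟨C, rfl, hC⟩ := h₂.of_shiftChan
      -- The right component does not mention the restricted channel, so the left one owns all that
      -- is assigned to its endpoints and can be restricted alone.
      have hB : B = Asg.bindChan o (fun v => B v.shiftChan) := by
        refine Asg.bindChan_ext ?_ ?_ fun _ => rfl
        · have := h (.ch 0 .neg); simp at this; grind
        · have := h (.ch 0 .pos); simp at this; grind
      refine ⟨fun v => B v.shiftChan, C, m, j, rfl, fun k => ?_, ⟨o, hB ▸ h₁⟩, hC⟩
      simpa using h k.shiftChan
  | resLoc l z P =>
    constructor
    · rintro ⟨o, m, j, hz, hn, h⟩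
      exact ⟨m, j, hz, hn, o, h⟩
    · rintro ⟨m, j, hz, hn, o, h⟩
      exact ⟨o, m, j, hz, hn, h⟩
  | branch k L _ ih => simp only [WT, ih]
  | _ => simp only [WT, *]

/-! Typable processes are well-typed in the syntax-directed system. -/

open Classical in
/-- The type that an assignment gives to `k`. -/
noncomputable def Assign.typeAt (k : Val) : Assign → Option STy
  | .active k' α => if k' = k then some α else none
  | .bracket _ _ => none

/-- `A` is the active part of `Δ`, in which no key occurs twice. -/
def Typing.Rep (Δ : Typing) (A : Asg) : Prop :=
  ∀ k, Δ.filterMap (Assign.typeAt k) = (A k).elim 0 fun α => {α}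

theorem Assign.typeAt_active_self (k : Val) (α : STy) :
    (Assign.active k α).typeAt k = some α := if_pos rfl

theorem Assign.typeAt_active_ne {k k' : Val} (h : k' ≠ k) (α : STy) :
    (Assign.active k' α).typeAt k = none := if_neg h

theorem Assign.typeAt_mapKey {f : Val → Val} (hf : Function.Injective f) (k : Val) (a : Assign) :
    (a.mapKey f).typeAt (f k) = a.typeAt k := by
  cases a <;> simp [Assign.mapKey, Assign.typeAt, hf.eq_iff]

namespace Typing

theorem Rep.of_map {f : Val → Val} (hf : Function.Injective f) {Δ : Typing} {A : Asg}
    (h : Rep (Δ.map (Assign.mapKey f)) A) : Rep Δ (A ∘ f) := by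
  intro k
  have := h (f k)
  rw [Multiset.filterMap_map] at this
  rw [Function.comp_apply, ← this]
  exact congrArg (fun g => Multiset.filterMap g Δ)
    (funext fun a => (Assign.typeAt_mapKey hf k a).symm)

theorem rep_zero : Rep 0 Asg.empty := fun _ => rfl

theorem Rep.eq_empty {A : Asg} (h : Rep 0 A) : A = Asg.empty := by
  refine Asg.eq_empty fun k => ?_
  have := h k
  cases hk : A k <;> simp [hk] at this
  rfl

theorem Rep.mem_iff {Δ : Typing} {A : Asg} (h : Rep Δ A) (k : Val) (α : STy) :
    Assign.active k α ∈ Δ ↔ A k = some α := by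
  have : α ∈ Δ.filterMap (Assign.typeAt k) ↔ Assign.active k α ∈ Δ := by
    rw [Multiset.mem_filterMap]
    constructor
    · rintro ⟨a | a, ha, h⟩
      · simp only [Assign.typeAt] at h
        split at h
        · simp_all
        · simp at h
      · simp [Assign.typeAt] at h
    · exact fun h => ⟨_, h, Assign.typeAt_active_self k α⟩
  rw [← this, h k]
  cases A k <;> simp [eq_comm]

theorem Rep.inDom_iff {Δ : Typing} {A : Asg} (h : Rep Δ A) (k : Val) :
    InDom k Δ ↔ A k ≠ none := by
  simp [InDom, h.mem_iff, Option.ne_none_iff_exists']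

theorem Rep.cons {Δ : Typing} {A : Asg} (h : Rep Δ A) {k : Val} (hk : A k = none) (α : STy) :
    Rep (.active k α ::ₘ Δ) (Function.update A k (some α)) := by
  intro k'
  rcases eq_or_ne k' k with rfl | hne
  · rw [Multiset.filterMap_cons_some _ _ _ (Assign.typeAt_active_self k' α), h k', hk]
    simp
  · rw [Multiset.filterMap_cons_none _ _ (Assign.typeAt_active_ne hne.symm α), h k',
      Function.update_of_ne hne]

theorem Rep.of_cons {Δ : Typing} {A : Asg} {k : Val} {α : STy} (h : Rep (.active k α ::ₘ Δ) A) :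
    A k = some α ∧ Rep Δ (Function.update A k none) := by
  have hk := (h.mem_iff k α).1 (Multiset.mem_cons_self _ _)
  refine ⟨hk, fun k' => ?_⟩
  have := h k'
  rcases eq_or_ne k' k with rfl | hne
  · rw [Multiset.filterMap_cons_some _ _ _ (Assign.typeAt_active_self k' α), hk] at this
    rw [Function.update_self]
    exact (Multiset.cons_inj_right α).1 this
  · rw [Multiset.filterMap_cons_none _ _ (Assign.typeAt_active_ne hne.symm α)] at this
    rw [this, Function.update_of_ne hne]

theorem Rep.replace {Δ : Typing} {A : Asg} {k : Val} {α : STy} (h : Rep (.active k α ::ₘ Δ) A)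
    (β : STy) : Rep (.active k β ::ₘ Δ) (Function.update A k (some β)) := by
  have := h.of_cons.2.cons (Function.update_self ..) β
  rwa [Function.update_idem] at this

theorem rep_bracket {Δ : Typing} {A : Asg} {p : Pol} {α : STy} :
    Rep (.bracket p α ::ₘ Δ) A ↔ Rep Δ A := by
  refine forall_congr' fun k => ?_
  rw [Multiset.filterMap_cons_none]
  rfl

theorem Rep.add {Δ₁ Δ₂ : Typing} {A₁ A₂ : Asg} (h₁ : Rep Δ₁ A₁) (h₂ : Rep Δ₂ A₂)
    (hd : ∀ k, A₁ k = none ∨ A₂ k = none) : Rep (Δ₁ + Δ₂) (A₁.join A₂) := by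
  intro k
  rw [Multiset.filterMap_add, h₁ k, h₂ k]
  rcases hd k with h | h <;> simp [Asg.join, h]

theorem Rep.of_bindVar {Δ : Typing} {A : Asg} {α : STy}
    (h : Rep (.active (.var 0) α ::ₘ Δ.shiftVar 1) A) :
    ∃ B, Rep Δ B ∧ A = Asg.bindVar 1 (some α) B := by
  obtain ⟨h₀, h⟩ := h.of_cons
  refine ⟨_, h.of_map (Val.shiftVar_injective 1), Asg.bindVar_ext ?_ ?_⟩
  · intro i hi
    obtain rfl : i = 0 := by omega
    exact h₀
  · intro v
    rw [Function.comp_apply, Function.update_of_ne (Val.var_ne_shiftVar one_pos v).symm]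

theorem Rep.of_shiftVar {Δ : Typing} {A : Asg} {n : ℕ} (h : Rep (Δ.shiftVar n) A) :
    ∃ B, Rep Δ B ∧ A = Asg.bindVar n none B := by
  refine ⟨_, h.of_map (Val.shiftVar_injective n), Asg.bindVar_ext (fun i hi => ?_) fun _ => rfl⟩
  by_contra hne
  obtain ⟨α, hα⟩ := (h.inDom_iff _).2 hne
  obtain ⟨a | a, -, ha⟩ := Multiset.mem_map.1 hα
  · simp only [Assign.mapKey, Assign.active.injEq] at ha
    exact Val.var_ne_shiftVar hi _ ha.1.symm
  · simp [Assign.mapKey] at ha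

theorem Rep.of_shiftChan {Δ : Typing} {A : Asg} (h : Rep Δ.shiftChan A) :
    ∃ B, Rep Δ B ∧ A = Asg.bindChan none B := by
  have h₀ : ∀ p, A (.ch 0 p) = none := by
    intro p
    by_contra hne
    obtain ⟨α, hα⟩ := (h.inDom_iff _).2 hne
    obtain ⟨a | a, -, ha⟩ := Multiset.mem_map.1 hα
    · simp only [Assign.mapKey, Assign.active.injEq] at ha
      exact Val.ch_zero_ne_shiftChan p _ ha.1.symm
    · simp [Assign.mapKey] at ha
  exact ⟨_, h.of_map Val.shiftChan_injective,
    Asg.bindChan_ext (h₀ _) (h₀ _) fun _ => rfl⟩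

end Typing

open Typing

/-- A typing is a multiset and could a priori contain a key twice; that it does not follows by
induction from the side conditions on domains. Bracketed assignments are invisible to `Rep` and
survive only in the cardinality. -/
theorem Typed.wt {Γ : Env} {Θ : HEnv} {P : Proc} {Δ : Typing} {I : Interface}
    (h : Typed Γ Θ P Δ I) : ∃ A, Δ.Rep A ∧ WT Γ P A (Multiset.card Δ) := by
  -- In a prefix rule the conclusion overwrites the type of the subject, and inversion in `WT`
  -- writes the type of the continuation back; this recovers the assignment of the premise.
  have upd : ∀ {Δ : Typing} {A : Asg} {k : Val} {α : STy} (β : STy),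
      Rep (.active k α ::ₘ Δ) A →
      Function.update (Function.update A k (some β)) k (some α) = A := by
    intro Δ A k α β h
    rw [Function.update_idem, Function.update_eq_self_iff, h.of_cons.1]
  induction h with
  | nil => exact ⟨_, rep_zero, rfl, .zero⟩
  | pvar => exact ⟨_, rep_zero, rfl, .zero⟩
  | accept ha _ ih =>
    obtain ⟨A, hA, h⟩ := ih
    obtain ⟨B, hB, rfl⟩ := hA.of_bindVar
    exact ⟨B, hB, _, _, _, rfl, ha, by simpa [Typing.shiftVar] using h⟩
  | request ha _ ih =>
    obtain ⟨A, hA, h⟩ := ih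
    obtain ⟨B, hB, rfl⟩ := hA.of_bindVar
    exact ⟨B, hB, _, _, _, rfl, ha, by simpa [Typing.shiftVar] using h⟩
  | repAccept ha _ ih =>
    obtain ⟨A, hA, h⟩ := ih
    obtain ⟨B, hB, rfl⟩ := Rep.of_bindVar (Δ := 0) hA
    exact ⟨_, rep_zero, rfl, .zero, _, _, _, rfl, ha, by simpa [hB.eq_empty] using h⟩
  | loc _ _ hh _ ih =>
    obtain ⟨A, hA, h⟩ := ih
    exact ⟨A, hA, _, 0, hh, rfl, h⟩
  | adapt _ _ ih =>
    obtain ⟨A, hA, h⟩ := ih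
    exact ⟨_, rep_zero, rfl, .zero, by simpa [hA.eq_empty] using h⟩
  | out he _ ih =>
    obtain ⟨A, hA, h⟩ := ih
    refine ⟨_, hA.replace _, _, _, he, Function.update_self .., ?_⟩
    rw [upd _ hA]
    simpa using h
  | inp _ ih =>
    obtain ⟨A, hA, h⟩ := ih
    obtain ⟨B, hB, rfl⟩ := hA.of_shiftVar
    refine ⟨_, hB.replace _, _, _, rfl, Function.update_self .., ?_⟩
    rw [upd _ hB]
    simpa [Typing.shiftVar] using h
  | @throwS _ _ k k' _ Δ α β _ _ _ hk' ih =>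
    obtain ⟨A, hA, h⟩ := ih
    rw [hA.inDom_iff, not_not] at hk'
    have hne : k ≠ k' := by
      rintro rfl
      rw [hA.of_cons.1] at hk'
      cases hk'
    have h₁ := hA.of_cons.2.cons (k := k') (by rwa [Function.update_of_ne hne.symm]) β
    have h₂ := h₁.cons (k := k) (by rw [Function.update_of_ne hne]; simp) (.throwT β α)
    refine ⟨_, h₂, α, β, _, by rw [Multiset.card_cons], hne, Function.update_self .., ?_, ?_⟩
    · rw [Function.update_of_ne hne.symm, Function.update_self]
    -- Giving `k` its old type and deleting `k'` recovers the assignment of the premise, because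
    -- `k'` was absent from it.
    · convert h using 1
      · funext v
        have := hA.of_cons.1
        simp only [Function.update_apply]
        grind
      · simp
  | catchS _ ih =>
    obtain ⟨A, hA, h⟩ := ih
    obtain ⟨B, hB, rfl⟩ := hA.of_bindVar
    refine ⟨_, hB.replace _, _, _, Function.update_self .., ?_⟩
    rw [upd _ hB]
    simpa [Typing.shiftVar] using h
  | @branch _ _ k L P Δ α _ hL _ ih =>
    choose A hA h using ih
    obtain ⟨i, hi⟩ := hL
    refine ⟨_, (hA ⟨i, hi⟩).replace _, ⟨i, hi⟩, _, Function.update_self .., fun j => ?_⟩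
    convert h j using 1
    -- Each premise comes with its own assignment. They agree up to the type of `k`, because a
    -- typing determines the assignment that represents it.
    · rw [Function.update_idem]
      have h₁ := (hA ⟨i, hi⟩).replace (α j)
      funext v
      have h₂ := (h₁ v).symm.trans (hA j v)
      revert h₂
      cases Function.update (A ⟨i, hi⟩) k (some (α j)) v <;> cases A j v <;> simp
    · simp
  | select hn _ ih =>
    obtain ⟨A, hA, h⟩ := ih
    refine ⟨_, hA.replace _, _, _, hn, Function.update_self .., ?_⟩
    rw [upd _ hA]
    simpa using h
  | par _ _ hd ih₁ ih₂ =>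
    obtain ⟨A, hA, h₁⟩ := ih₁
    obtain ⟨B, hB, h₂⟩ := ih₂
    have : ∀ k, A k = none ∨ B k = none := by
      intro k
      have := hd k
      rw [hA.inDom_iff, hB.inDom_iff] at this
      tauto
    exact ⟨_, hA.add hB this, A, B, _, _, Multiset.card_add _ _, split_join this, h₁, h₂⟩
  | ite he _ _ ih₁ ih₂ =>
    obtain ⟨A, hA, h₁⟩ := ih₁
    obtain ⟨B, hB, h₂⟩ := ih₂
    have : B = A := by
      funext v
      have h₂ := (hB v).symm.trans (hA v)
      revert h₂
      cases B v <;> cases A v <;> simp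
    exact ⟨A, hA, he, h₁, this ▸ h₂⟩
  | close _ _ hk ih =>
    obtain ⟨A, hA, h⟩ := ih
    rw [hA.inDom_iff, not_not] at hk
    refine ⟨_, hA.cons hk _, _, Multiset.card_cons _ _, Function.update_self .., ?_⟩
    rwa [Function.update_idem, Function.update_eq_self_iff.2 hk.symm]
  | @res _ _ P Δ α _ _ ih =>
    obtain ⟨A, hA, h⟩ := ih
    obtain ⟨h₁, hA⟩ := hA.of_cons
    obtain ⟨h₂, hA⟩ := hA.of_cons
    obtain ⟨B, hB, hAB⟩ := hA.of_shiftChan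
    refine ⟨B, rep_bracket.2 (rep_bracket.2 hB), some α, ?_⟩
    convert h using 1
    · symm
      refine Asg.bindChan_ext h₁ ?_ fun v => ?_
      · rwa [Function.update_of_ne (by simp)] at h₂
      · have := congrFun hAB v.shiftChan
        rwa [Asg.bindChan_shiftChan, Function.update_of_ne (Val.ch_zero_ne_shiftChan _ _).symm,
          Function.update_of_ne (Val.ch_zero_ne_shiftChan _ _).symm] at this
    · simp [Typing.shiftChan]
  | resUnused _ ih =>
    obtain ⟨A, hA, h⟩ := ih
    obtain ⟨B, hB, rfl⟩ := hA.of_shiftChan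
    exact ⟨B, hB, none, by simpa [Typing.shiftChan] using h⟩
  | weak _ ih =>
    obtain ⟨A, hA, h⟩ := ih
    exact ⟨A, rep_bracket.2 (rep_bracket.2 hA), by simpa using h.weak 1⟩
  | subs _ _ ih => exact ih

/-! Substitution of processes for process variables. -/

theorem WT.renPVar {Γ : Env} {P : Proc} {ξ : ℕ → ℕ} {A : Asg} {n : ℕ} (h : WT Γ P A n) :
    WT Γ (P.renPVar ξ) A n := by
  induction P generalizing Γ ξ A n <;> simp only [Proc.renPVar, WT] at h ⊢ <;> grind

theorem WT.shiftVar_empty {Γ Γ' : Env} {P : Proc} {m n : ℕ} (h : WT Γ P Asg.empty n)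
    (hn : Γ'.name = Γ.name) (hv : ∀ i, Γ'.var (i + m) = Γ.var i) :
    WT Γ' (P.shiftVar m) Asg.empty n :=
  h.subst ⟨hn, fun _ _ h => .var (by rwa [hv])⟩ (KeyMap.empty _)

theorem WT.shiftChan_empty {Γ : Env} {P : Proc} {n : ℕ} (h : WT Γ P Asg.empty n) :
    WT Γ P.shiftChan Asg.empty n := by
  simpa using h.shiftChan

/-- A process without keys and with count zero fits wherever a process variable does, in any number
of copies and below any binder: process variables have the empty assignment, and their even count is
supplied by weakening. -/
theorem WT.substPVar {Γ : Env} {P : Proc} {θ : ℕ → Proc} {A : Asg} {n : ℕ} (h : WT Γ P A n)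
    (hθ : ∀ X, WT Γ (θ X) Asg.empty 0) : WT Γ (P.substPVar θ) A n := by
  have sess : ∀ {Γ : Env} {θ : ℕ → Proc}, (∀ X, WT Γ (θ X) Asg.empty 0) →
      ∀ X, WT Γ.bindSess ((θ X).shiftVar 1) Asg.empty 0 :=
    fun h X => (h X).shiftVar_empty rfl fun _ => rfl
  induction P generalizing Γ θ A n with
  | nil => exact h
  | pvar X =>
    obtain ⟨rfl, h⟩ := h
    have := (hθ X).of_even h
    rwa [zero_add] at this
  | adapt l P ih =>
    refine ⟨h.1, h.2.1, ih h.2.2 fun X => ?_⟩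
    cases X with
    | zero => exact ⟨rfl, .zero⟩
    | succ X => exact (hθ X).renPVar
  | repAccept a P ih =>
    obtain ⟨rfl, h₀, b, α, q, h₁, h₂, h₃⟩ := h
    exact ⟨rfl, h₀, b, α, q, h₁, h₂, ih h₃ (sess hθ)⟩
  | accept a P ih =>
    obtain ⟨b, α, q, h₁, h₂, h₃⟩ := h
    exact ⟨b, α, q, h₁, h₂, ih h₃ (sess hθ)⟩
  | request a P ih =>
    obtain ⟨b, α, q, h₁, h₂, h₃⟩ := h
    exact ⟨b, α, q, h₁, h₂, ih h₃ (sess hθ)⟩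
  | loc l z P ih =>
    obtain ⟨m, i, h₁, rfl, h₃⟩ := h
    exact ⟨m, i, h₁, rfl, ih h₃ hθ⟩
  | out k es P ih =>
    obtain ⟨τs, α, h₁, h₂, h₃⟩ := h
    exact ⟨τs, α, h₁, h₂, ih h₃ hθ⟩
  | inp k m P ih =>
    obtain ⟨τs, α, rfl, h₂, h₃⟩ := h
    exact ⟨τs, α, rfl, h₂, ih h₃ fun X => (hθ X).shiftVar_empty rfl (Env.bindVals_add Γ τs)⟩
  | throwS k k' P ih =>
    obtain ⟨α, β, m, rfl, h₂, h₃, h₄, h₅⟩ := h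
    exact ⟨α, β, m, rfl, h₂, h₃, h₄, ih h₅ hθ⟩
  | catchS k P ih =>
    obtain ⟨α, β, h₂, h₃⟩ := h
    exact ⟨α, β, h₂, ih h₃ (sess hθ)⟩
  | branch k L P ih =>
    obtain ⟨hL, α, h₂, h₃⟩ := h
    exact ⟨hL, α, h₂, fun i => ih i (h₃ i) hθ⟩
  | select k i P ih =>
    obtain ⟨L, α, hi, h₂, h₃⟩ := h
    exact ⟨L, α, hi, h₂, ih h₃ hθ⟩
  | par P Q ihP ihQ =>
    obtain ⟨B, C, m, i, rfl, h₁, h₂, h₃⟩ := h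
    exact ⟨B, C, m, i, rfl, h₁, ihP h₂ hθ, ihQ h₃ hθ⟩
  | ite e P Q ihP ihQ => exact ⟨h.1, ihP h.2.1 hθ, ihQ h.2.2 hθ⟩
  | close k P ih =>
    obtain ⟨m, rfl, h₂, h₃⟩ := h
    exact ⟨m, rfl, h₂, ih h₃ hθ⟩
  | res P ih =>
    obtain ⟨o, h⟩ := h
    exact ⟨o, ih h fun X => (hθ X).shiftChan_empty⟩

/-! Contexts. -/

@[simp] theorem Ctx.bump_zero (C : Ctx) : C.bump 0 = C := by
  induction C <;> simp_all [Ctx.bump]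

theorem Ctx.fill_shiftChan (C : Ctx) (P : Proc) :
    (C.fill P).shiftChan = C.shiftChan.fill P.shiftChan := by
  induction C with
  | hole => rfl
  | loc l h C Q ih => exact congrArg (fun R => Proc.loc l h (.par R Q.shiftChan)) ih

/-- The content of the hole of a well-typed context can be exchanged. -/
theorem WT.fill {Γ : Env} {C : Ctx} {P : Proc} {A : Asg} {n : ℕ} (h : WT Γ (C.fill P) A n) :
    ∃ B F m j, n = m + j ∧ Split A B F ∧ WT Γ P B m ∧
      ∀ (P' : Proc) (A' B' : Asg) (m' : ℕ) (z : ℤ), (m' : ℤ) = m + z → Split A' B' F →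
        WT Γ P' B' m' → WT Γ ((C.bump z).fill P') A' (m' + j) := by
  induction C generalizing A n with
  | hole =>
    refine ⟨A, Asg.empty, n, 0, rfl, .empty_right A, h, ?_⟩
    intro P' A' B' m' z _ hs h'
    rwa [split_empty_right.1 hs]
  | loc l z C Q ih =>
    obtain ⟨m, j, rfl, rfl, A₁, A₂, m₁, m₂, rfl, hs, h₁, h₂⟩ := h
    obtain ⟨B, F, m, i, rfl, hs', hP, hfill⟩ := ih h₁
    obtain ⟨hs₁, hs₂⟩ := hs.assoc hs'
    refine ⟨B, F.join A₂, m, i + m₂ + 2 * j, by ring, hs₁, hP, ?_⟩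
    intro P' A' B' m' z hz hs'' h'
    obtain ⟨hs₃, hs₄⟩ := hs''.assoc_left hs₂
    -- The annotation was `m + i + m₂`, so replacing `m` by `m'` changes it by exactly `z`; the
    -- slack `j` of the location is kept.
    refine ⟨m' + i + m₂, j, by push_cast; omega, by ring, _, A₂, m' + i, m₂, rfl, hs₃, ?_, h₂⟩
    exact hfill P' _ B' m' z hz hs₄ h'

/-- `A` is the disjoint union of `B`, `C` and `F`. -/
def Split₃ (A B C F : Asg) : Prop :=
  ∀ k, (A k = B k ∧ C k = none ∧ F k = none) ∨ (A k = C k ∧ B k = none ∧ F k = none) ∨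
    (A k = F k ∧ B k = none ∧ C k = none)

theorem WT.par_fill {Γ : Env} {C D : Ctx} {P Q : Proc} {A : Asg} {n : ℕ}
    (h : WT Γ (.par (C.fill P) (D.fill Q)) A n) :
    ∃ B₁ B₂ F m₁ m₂ j, n = m₁ + m₂ + j ∧ Split₃ A B₁ B₂ F ∧ WT Γ P B₁ m₁ ∧ WT Γ Q B₂ m₂ ∧
      ∀ (P' Q' : Proc) (A' B₁' B₂' : Asg) (m₁' m₂' : ℕ) (z₁ z₂ : ℤ),
        (m₁' : ℤ) = m₁ + z₁ → (m₂' : ℤ) = m₂ + z₂ → Split₃ A' B₁' B₂' F →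
        WT Γ P' B₁' m₁' → WT Γ Q' B₂' m₂' →
        WT Γ (.par ((C.bump z₁).fill P') ((D.bump z₂).fill Q')) A' (m₁' + m₂' + j) := by
  obtain ⟨A₁, A₂, n₁, n₂, rfl, hs, h₁, h₂⟩ := h
  obtain ⟨B₁, F₁, m₁, j₁, rfl, hs₁, hP, hfill₁⟩ := h₁.fill
  obtain ⟨B₂, F₂, m₂, j₂, rfl, hs₂, hQ, hfill₂⟩ := h₂.fill
  refine ⟨B₁, B₂, F₁.join F₂, m₁, m₂, j₁ + j₂, by ring, ?_, hP, hQ, ?_⟩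
  · intro k
    have := hs k
    have := hs₁ k
    have := hs₂ k
    simp only [Asg.join]
    grind
  · intro P' Q' A' B₁' B₂' m₁' m₂' z₁ z₂ hz₁ hz₂ hs' hP' hQ'
    have hF : ∀ k, F₁ k = none ∨ F₂ k = none := by
      intro k
      have := hs k
      have := hs₁ k
      have := hs₂ k
      grind
    have key : ∀ k, ((F₁.join F₂) k = none ↔ F₁ k = none ∧ F₂ k = none) := by
      simp [Asg.join]
    refine ⟨B₁'.join F₁, B₂'.join F₂, m₁' + j₁, m₂' + j₂, by ring, ?_,
      hfill₁ P' _ B₁' m₁' z₁ hz₁ (split_join ?_) hP', hfill₂ Q' _ B₂' m₂' z₂ hz₂ (split_join ?_) hQ'⟩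
    · intro k
      have := hs' k
      have := hF k
      simp only [Asg.join] at *
      grind
    · intro k
      have := hs' k
      have := key k
      grind
    · intro k
      have := hs' k
      have := key k
      grind

/-- The contents of both holes around a redex can be exchanged. -/
theorem WT.fill_par_fill {Γ : Env} {E C D : Ctx} {P Q : Proc} {A : Asg} {n : ℕ}
    (h : WT Γ (E.fill (.par (C.fill P) (D.fill Q))) A n) :
    ∃ B₁ B₂ F m₁ m₂, Split₃ A B₁ B₂ F ∧ WT Γ P B₁ m₁ ∧ WT Γ Q B₂ m₂ ∧
      ∀ (P' Q' : Proc) (A' B₁' B₂' : Asg) (m₁' m₂' : ℕ) (z₁ z₂ : ℤ),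
        (m₁' : ℤ) = m₁ + z₁ → (m₂' : ℤ) = m₂ + z₂ → Split₃ A' B₁' B₂' F →
        WT Γ P' B₁' m₁' → WT Γ Q' B₂' m₂' →
        ∃ n', WT Γ ((E.bump (z₁ + z₂)).fill
          (.par ((C.bump z₁).fill P') ((D.bump z₂).fill Q'))) A' n' := by
  obtain ⟨A₀, G, m, j, rfl, hs, h₀, hfill⟩ := h.fill
  obtain ⟨B₁, B₂, F, m₁, m₂, i, rfl, hs₀, hP, hQ, hfill₀⟩ := h₀.par_fill
  refine ⟨B₁, B₂, F.join G, m₁, m₂, ?_, hP, hQ, ?_⟩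
  · intro k
    have := hs k
    have := hs₀ k
    simp only [Asg.join]
    grind
  · intro P' Q' A' B₁' B₂' m₁' m₂' z₁ z₂ hz₁ hz₂ hs' hP' hQ'
    have hG : ∀ k, F k = none ∨ G k = none := by
      intro k
      have := hs k
      have := hs₀ k
      grind
    refine ⟨_, hfill _ A' ((B₁'.join B₂').join F) _ (z₁ + z₂) ?_ ?_
      (hfill₀ P' Q' _ B₁' B₂' m₁' m₂' z₁ z₂ hz₁ hz₂ ?_ hP' hQ')⟩
    · push_cast; omega
    · intro k
      have := hs' k
      have := hG k
      simp only [Asg.join] at *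
      grind
    · intro k
      have := hs' k
      simp only [Asg.join] at *
      grind

/-! Duality of the endpoints of a channel. -/

/-- The endpoints of a channel have dual types. -/
def Asg.Compat (A : Asg) : Prop :=
  ∀ κ p α β, A (.ch κ p) = some α → A (.ch κ p.opp) = some β → β = α.dual

/-- `A` evolves to `A'` in a reduction: the types of a channel change only if both endpoints are
in `A`, and then either both disappear or both get dual types. -/
def Evolves (A A' : Asg) : Prop :=
  (∀ k, A k = none → A' k = none) ∧
  ∀ κ, (∀ p, A' (.ch κ p) = A (.ch κ p)) ∨
    ((∀ p, A (.ch κ p) ≠ none) ∧ A' (.ch κ .pos) = (A' (.ch κ .neg)).map STy.dual)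

theorem Evolves.refl (A : Asg) : Evolves A A := ⟨fun _ h => h, fun _ => .inl fun _ => rfl⟩

theorem Evolves.compat {A A' : Asg} (h : Evolves A A') (hA : A.Compat) : A'.Compat := by
  intro κ p α β h₁ h₂
  rcases h.2 κ with h | ⟨-, h⟩
  · rw [h] at h₁ h₂
    exact hA κ p α β h₁ h₂
  · cases p
    · rw [h] at h₁
      simp only [Pol.opp] at h₂
      simp [h₂] at h₁
      simp [← h₁]
    · simp only [Pol.opp] at h₂
      simp [h, h₁] at h₂
      exact h₂.symm

theorem Evolves.of_channel {A A' : Asg} (κ : ℕ) (p : Pol) (h : A (.ch κ p) ≠ none)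
    (h' : A (.ch κ p.opp) ≠ none) (hd : A' (.ch κ p.opp) = (A' (.ch κ p)).map STy.dual)
    (hA : ∀ k, k ≠ .ch κ p → k ≠ .ch κ p.opp → A' k = A k) : Evolves A A' := by
  constructor
  · intro k hk
    rw [hA k, hk]
    · rintro rfl; exact h hk
    · rintro rfl; exact h' hk
  · intro κ'
    rcases eq_or_ne κ' κ with rfl | hne
    · right
      cases p
      · refine ⟨fun q => by cases q <;> assumption, ?_⟩
        change A' (.ch κ' .neg) = _ at hd
        rw [hd, Option.map_map]
        cases A' (.ch κ' .pos) <;> simp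
      · exact ⟨fun q => by cases q <;> assumption, hd⟩
    · left
      intro q
      apply hA <;> simp [hne]

theorem Asg.Compat.bindChan {A : Asg} (h : A.Compat) (o : Option STy) :
    (A.bindChan o).Compat := by
  intro κ p α β h₁ h₂
  cases κ with
  | zero =>
    cases p
    · simp only [Pol.opp, Asg.bindChan_neg] at h₂
      simp [h₂] at h₁
      simp [← h₁]
    · simp only [Asg.bindChan_neg] at h₁
      simp [Pol.opp, h₁] at h₂
      exact h₂.symm
  | succ κ => exact h κ p α β (by simpa using h₁) (by simpa using h₂)

/-- This is the reason for `Asg.Compat` in place of balance, which a component owning only one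
endpoint of a channel would violate. -/
theorem Split.compat_left {A B C : Asg} (hs : Split A B C) (h : A.Compat) : B.Compat := by
  intro κ p α β h₁ h₂
  have := hs (.ch κ p)
  have := hs (.ch κ p.opp)
  exact h κ p α β (by grind) (by grind)

/-- The restricted channel either keeps its types or ends with dual types or none, so the new
assignment again has the form required below a restriction. -/
theorem Evolves.of_bindChan {A B : Asg} {o : Option STy} (h : Evolves (A.bindChan o) B) :
    ∃ A' o', B = A'.bindChan o' ∧ Evolves A A' := by
  refine ⟨fun v => B v.shiftChan, B (.ch 0 .neg), Asg.bindChan_ext rfl ?_ fun _ => rfl, ?_, ?_⟩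
  · rcases h.2 0 with h | ⟨-, h⟩
    · rw [h, h]; simp
    · exact h
  · intro k hk
    exact h.1 _ (by simpa using hk)
  · intro κ
    have := h.2 (κ + 1)
    simp only [Asg.bindChan_succ] at this
    exact this

/-- A channel changes only if `B` owns both of its endpoints; then `C` owns neither, and the change
does not interfere with it. -/
theorem Evolves.split {A B C B' : Asg} (hs : Split A B C) (h : Evolves B B') :
    Split (B'.join C) B' C ∧ Evolves A (B'.join C) := by
  refine ⟨split_join fun k => ?_, fun k hk => ?_, fun κ => ?_⟩
  · have := hs k
    have := h.1 k
    grind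
  · have := hs k
    have := h.1 k
    simp only [Asg.join]
    grind
  · rcases h.2 κ with h | ⟨h₁, h₂⟩
    · left
      intro p
      have := hs (.ch κ p)
      have := h p
      simp only [Asg.join]
      grind
    · right
      have key : ∀ p, A (.ch κ p) = B (.ch κ p) ∧ C (.ch κ p) = none := by
        intro p
        have := hs (.ch κ p)
        have := h₁ p
        grind
      refine ⟨fun p => by rw [(key p).1]; exact h₁ p, ?_⟩
      simp [Asg.join, (key _).2, h₂]

/-! Instantiation of bound names. -/

theorem ExprTyped.eval {Γ : Env} {e : Expr} {c : Val} {τ : BTy} (h : ExprTyped Γ e τ)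
    (he : Eval e c) : ExprTyped Γ (.val c) τ := by
  cases he with
  | val => exact h
  | add => cases h; exact .int _
  | sub => cases h; exact .int _
  | eq => cases h; exact .bool _
  | le => cases h; exact .bool _
  | and => cases h; exact .bool _
  | not => cases h; exact .bool _

theorem Val.subst_inst_shiftVar (cs : List Val) (v : Val) :
    (v.shiftVar cs.length).subst (fun i => cs.getD i (.var (i - cs.length))) id = v := by
  cases v <;> simp [Val.shiftVar, Val.subst]

/-- The bound names of an input are not keys, so replacing them leaves the keys outside the binder
as they are; only the basic types have to be respected. -/
theorem WT.inst_const {Γ : Env} {τs : List BTy} {cs : List Val} {P : Proc} {A : Asg} {n : ℕ}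
    (h : WT (Γ.bindVals τs) P (A.bindVar cs.length none) n)
    (hc : List.Forall₂ (fun c τ => ExprTyped Γ (.val c) τ) cs τs) : WT Γ (P.inst cs) A n := by
  refine h.subst ⟨rfl, fun i τ hi => ?_⟩ ⟨fun v hv => ?_, fun w hw => ?_, fun v w hv hw e => ?_⟩
  · have hl := hc.length_eq
    by_cases hlt : i < τs.length
    · simp only [Env.bindVals, if_pos hlt] at hi
      have hlt' : i < cs.length := by omega
      have := hc.get (i := i) hlt' hlt
      rw [List.getElem?_eq_getElem hlt, Option.some.injEq] at hi
      subst hi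
      rw [List.getD_eq_getElem _ _ hlt']
      exact this
    · simp only [Env.bindVals, if_neg hlt] at hi
      rw [List.getD_eq_default _ _ (by omega), hl]
      exact .var hi
  · rcases Val.bound_or_shiftVar cs.length v with ⟨i, hi, rfl⟩ | ⟨u, rfl⟩
    · exact (hv (Asg.bindVar_var hi _ _)).elim
    · rw [Val.subst_inst_shiftVar, Asg.bindVar_shiftVar]
  · exact ⟨w.shiftVar cs.length, by rwa [Asg.bindVar_shiftVar], Val.subst_inst_shiftVar cs w⟩
  · rcases Val.bound_or_shiftVar cs.length v with ⟨i, hi, rfl⟩ | ⟨u, rfl⟩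
    · exact (hv (Asg.bindVar_var hi _ _)).elim
    rcases Val.bound_or_shiftVar cs.length w with ⟨i, hi, rfl⟩ | ⟨u', rfl⟩
    · exact (hw (Asg.bindVar_var hi _ _)).elim
    rw [Val.subst_inst_shiftVar, Val.subst_inst_shiftVar] at e
    rw [e]

/-- The hypothesis `hκ` gives injectivity: the endpoint put in place of the bound name is not yet a
key of the process. -/
theorem WT.inst_chan {Γ : Env} {P : Proc} {A : Asg} {α : STy} {κ : ℕ} {p : Pol} {n : ℕ}
    (h : WT Γ.bindSess P (A.bindVar 1 (some α)) n) (hκ : A (.ch κ p) = none) :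
    WT Γ (P.inst [.ch κ p]) (Function.update A (.ch κ p) (some α)) n := by
  have h₀ : (Val.var 0).subst (fun i => [Val.ch κ p].getD i (.var (i - [Val.ch κ p].length))) id =
      .ch κ p := rfl
  have h₁ := Val.subst_inst_shiftVar [.ch κ p]
  have hne : ∀ u : Val, A u ≠ none → u ≠ .ch κ p := by rintro u hu rfl; exact hu hκ
  refine h.subst ⟨rfl, fun i τ hi => ?_⟩ ⟨fun v hv => ?_, fun w hw => ?_, fun v w hv hw e => ?_⟩
  · cases i with
    | zero => simp [Env.bindSess] at hi
    | succ i => exact .var hi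
  · rcases Val.bound_or_shiftVar 1 v with ⟨i, hi, rfl⟩ | ⟨u, rfl⟩
    · obtain rfl : i = 0 := by omega
      rw [h₀, Function.update_self, Asg.bindVar_var one_pos]
    · rw [Asg.bindVar_shiftVar] at hv ⊢
      refine (congrArg _ (h₁ u)).trans ?_
      rw [Function.update_of_ne (hne u hv)]
  · rcases eq_or_ne w (.ch κ p) with rfl | hw'
    · exact ⟨.var 0, by simp [Asg.bindVar], h₀⟩
    · rw [Function.update_of_ne hw'] at hw
      exact ⟨w.shiftVar 1, by rwa [Asg.bindVar_shiftVar], h₁ w⟩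
  · rcases Val.bound_or_shiftVar 1 v with ⟨i, hi, rfl⟩ | ⟨u, rfl⟩ <;>
      rcases Val.bound_or_shiftVar 1 w with ⟨i', hi', rfl⟩ | ⟨u', rfl⟩
    · obtain rfl : i = 0 := by omega
      obtain rfl : i' = 0 := by omega
      rfl
    · obtain rfl : i = 0 := by omega
      rw [Asg.bindVar_shiftVar] at hw
      exact (hne u' hw ((h₁ u').symm.trans (e.symm.trans h₀))).elim
    · obtain rfl : i' = 0 := by omega
      rw [Asg.bindVar_shiftVar] at hv
      exact (hne u hv ((h₁ u).symm.trans (e.trans h₀))).elim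
    · rw [(h₁ u).symm.trans (e.trans (h₁ u'))]

/-! Subject reduction. -/

/-- Common part of the plain and the replicated session opening. The whole redex is first moved
below an unused restriction, where the endpoints of channel `0` are available to both sides. Each
side gains one assignment, hence the surrounding context gains two, while the assignment outside
does not change. -/
theorem WT.session_init {Γ : Env} {E C D : Ctx} {P Q R S : Proc} {A : Asg} {n : ℕ}
    (h : WT Γ (E.fill (.par (C.fill R) (D.fill S))) A n)
    (hRS : ∀ B₁ B₂ m₁ m₂, WT Γ R.shiftChan B₁ m₁ → WT Γ S.shiftChan B₂ m₂ →
      (∀ p, B₁ (.ch 0 p) = none) → (∀ p, B₂ (.ch 0 p) = none) → ∃ α : STy,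
      WT Γ P (Function.update B₁ (.ch 0 .pos) (some α)) (m₁ + 1) ∧
      WT Γ Q (Function.update B₂ (.ch 0 .neg) (some α.dual)) (m₂ + 1)) :
    ∃ n', WT Γ ((E.bump 2).fill (.res (.par ((C.shiftChan.bump 1).fill P)
      ((D.shiftChan.bump 1).fill Q)))) A n' := by
  obtain ⟨A₀, G, m, j, rfl, hs, h₀, hfill⟩ := h.fill
  have h₁ : WT Γ (.par (C.shiftChan.fill R.shiftChan) (D.shiftChan.fill S.shiftChan))
      (A₀.bindChan none) m := by
    rw [← Ctx.fill_shiftChan, ← Ctx.fill_shiftChan]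
    exact h₀.shiftChan
  obtain ⟨B₁, B₂, F, m₁, m₂, i, rfl, hs₀, hP, hQ, hfill₀⟩ := h₁.par_fill
  have h₀ : ∀ p, B₁ (.ch 0 p) = none ∧ B₂ (.ch 0 p) = none ∧ F (.ch 0 p) = none := by
    intro p
    have := hs₀ (.ch 0 p)
    cases p <;> simp at this <;> grind
  obtain ⟨α, hP', hQ'⟩ := hRS B₁ B₂ m₁ m₂ hP hQ (fun p => (h₀ p).1) (fun p => (h₀ p).2.1)
  -- `Asg.bindChan` records the type of the negative endpoint, which is that of the requesting side;
  -- the positive one gets its dual, which is `α` again.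
  refine ⟨_, hfill _ A A₀ (m₁ + 1 + (m₂ + 1) + i) 2 (by push_cast; ring) hs ⟨some α.dual, ?_⟩⟩
  refine hfill₀ _ _ _ _ _ _ _ 1 1 (by simp) (by simp) ?_ hP' hQ'
  intro k
  rcases Val.bound_or_shiftChan k with ⟨p, rfl⟩ | ⟨u, rfl⟩
  · cases p <;> simp [h₀]
  · have := hs₀ u.shiftChan
    rw [Function.update_of_ne (Val.ch_zero_ne_shiftChan _ _).symm,
      Function.update_of_ne (Val.ch_zero_ne_shiftChan _ _).symm]
    simpa using this

theorem Proc.accept_shiftChan (a : Name) (P : Proc) :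
    (Proc.accept (.nm a) P).shiftChan = .accept (.nm a) P.shiftChan := by
  simp [Proc.shiftChan, Proc.renChan, Proc.subst, Val.subst]

theorem Proc.repAccept_shiftChan (a : Name) (P : Proc) :
    (Proc.repAccept (.nm a) P).shiftChan = .repAccept (.nm a) P.shiftChan := by
  simp [Proc.shiftChan, Proc.renChan, Proc.subst, Val.subst]

theorem Proc.request_shiftChan (a : Name) (P : Proc) :
    (Proc.request (.nm a) P).shiftChan = .request (.nm a) P.shiftChan := by
  simp [Proc.shiftChan, Proc.renChan, Proc.subst, Val.subst]

theorem Pol.ne_opp (p : Pol) : p ≠ p.opp := by cases p <;> simp [Pol.opp]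

/-- Common part of value communication and label selection, in which both endpoints advance to dual
continuations and no count changes. -/
theorem WT.communicate {Γ : Env} {E C D : Ctx} {P Q P' Q' : Proc} {A : Asg} {n κ : ℕ} {p : Pol}
    (hA : A.Compat) (h : WT Γ (E.fill (.par (C.fill P) (D.fill Q))) A n)
    (hPQ : ∀ B₁ B₂ m₁ m₂, WT Γ P B₁ m₁ → WT Γ Q B₂ m₂ →
      (∀ α β, B₁ (.ch κ p) = some α → B₂ (.ch κ p.opp) = some β → β = α.dual) →
      B₁ (.ch κ p) ≠ none ∧ B₂ (.ch κ p.opp) ≠ none ∧ ∃ α : STy,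
      WT Γ P' (Function.update B₁ (.ch κ p) (some α)) m₁ ∧
      WT Γ Q' (Function.update B₂ (.ch κ p.opp) (some α.dual)) m₂) :
    ∃ A' n', Evolves A A' ∧ WT Γ (E.fill (.par (C.fill P') (D.fill Q'))) A' n' := by
  obtain ⟨B₁, B₂, F, m₁, m₂, hs, hP, hQ, hfill⟩ := h.fill_par_fill
  have hp := p.ne_opp
  have s₁ := hs (.ch κ p)
  have s₂ := hs (.ch κ p.opp)
  obtain ⟨h₁, h₂, α, hP', hQ'⟩ := hPQ B₁ B₂ m₁ m₂ hP hQ fun α β ha hb =>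
    hA κ p α β (by grind) (by grind)
  refine ⟨Function.update (Function.update A (.ch κ p) (some α)) (.ch κ p.opp) (some α.dual),
    ?_⟩
  have hr := hfill P' Q'
    (Function.update (Function.update A (.ch κ p) (some α)) (.ch κ p.opp) (some α.dual))
    _ _ m₁ m₂ 0 0 (by simp) (by simp) ?_ hP' hQ'
  · obtain ⟨n', h⟩ := hr
    refine ⟨n', .of_channel κ p (by grind) (by grind) ?_ ?_, by simpa using h⟩
    · rw [Function.update_self, Function.update_of_ne (by simp [hp]), Function.update_self]
      rfl
    · intro k hk hk'
      rw [Function.update_of_ne hk', Function.update_of_ne hk]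
  · intro k
    have := hs k
    simp only [Function.update_apply]
    grind

/-- Duality is used when two prefixes meet: each side is typed at its own endpoint, and `hA` makes
the two continuations fit. `Evolves` in the conclusion is what the closure under parallel
composition and restriction requires. -/
theorem Red.wt {P Q : Proc} (h : Red P Q) {Γ : Env} {A : Asg} {n : ℕ} (hA : A.Compat)
    (hP : WT Γ P A n) : ∃ A' n', Evolves A A' ∧ WT Γ Q A' n' := by
  induction h generalizing A n with
  | openS E C D a P Q =>
    have hr := hP.session_init (P := P.shiftChan.inst [.ch 0 .pos])
      (Q := Q.shiftChan.inst [.ch 0 .neg]) ?_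
    · obtain ⟨n', h⟩ := hr
      exact ⟨A, n', .refl A, h⟩
    · intro B₁ B₂ m₁ m₂ h₁ h₂ hB₁ hB₂
      rw [Proc.accept_shiftChan] at h₁
      rw [Proc.request_shiftChan] at h₂
      obtain ⟨b, α, q, hb, hα, h₁⟩ := h₁
      obtain ⟨b', β, q', hb', hβ, h₂⟩ := h₂
      cases hb
      cases hb'
      rw [hα] at hβ
      cases hβ
      exact ⟨α, h₁.inst_chan (hB₁ _), h₂.inst_chan (hB₂ _)⟩
  | repOpenS E C D a P Q =>
    have hr := hP.session_init
      (P := .par (P.shiftChan.inst [.ch 0 .pos]) (.repAccept (.nm a) P.shiftChan))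
      (Q := Q.shiftChan.inst [.ch 0 .neg]) ?_
    · obtain ⟨n', h⟩ := hr
      exact ⟨A, n', .refl A, h⟩
    · intro B₁ B₂ m₁ m₂ h₁ h₂ hB₁ hB₂
      rw [Proc.repAccept_shiftChan] at h₁
      rw [Proc.request_shiftChan] at h₂
      have h₁' := h₁
      obtain ⟨rfl, -, b, α, q, hb, hα, h₁⟩ := h₁
      obtain ⟨b', β, q', hb', hβ, h₂⟩ := h₂
      cases hb
      cases hb'
      rw [hα] at hβ
      cases hβ
      -- The new copy owns just the fresh endpoint, with count one; the replicated process keeps the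
      -- empty assignment and the old count.
      exact ⟨α, ⟨_, Asg.empty, 1, m₁, add_comm _ _, .empty_right _, h₁.inst_chan (hB₁ _), h₁'⟩,
        h₂.inst_chan (hB₂ _)⟩
  | upd E C D l P Q =>
    obtain ⟨B₁, B₂, F, m₁, m₂, hs, hP, hQ, hfill⟩ := hP.fill_par_fill
    obtain ⟨m, j, hm, rfl, hP⟩ := hP
    obtain ⟨rfl, hm₂, hQ⟩ := hQ
    -- The annotation `0` forces the located process to have no assignments, hence no keys, so it
    -- may be substituted freely.
    obtain rfl : m = 0 := by simpa using hm.symm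
    obtain rfl := hP.cardLE.eq_empty
    -- The slack of the location that disappears is restored by weakening, so that the count in this
    -- hole, and with it all annotations around it, stays the same.
    have : WT Γ (P.instPVar Q) Asg.empty (0 + 2 * j) := by
      refine (hQ.substPVar fun X => ?_).weak j
      cases X with
      | zero => exact hP
      | succ X => exact ⟨rfl, .zero⟩
    obtain ⟨n', h⟩ := hfill (P.instPVar Q) .nil A _ _ _ _ 0 0 (by simp) (by simp) hs this
      ⟨rfl, hm₂⟩
    exact ⟨A, n', .refl A, by simpa using h⟩
  | comm E C D κ p es cs P Q he =>
    refine WT.communicate (κ := κ) (p := p) hA hP fun B₁ B₂ m₁ m₂ h₁ h₂ hd => ?_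
    obtain ⟨τs, α, he', hα, h₁⟩ := h₁
    obtain ⟨τs', β, hl, hβ, h₂⟩ := h₂
    have := hd _ _ hα hβ
    simp only [STy.dual, STy.recv.injEq] at this
    obtain ⟨rfl, rfl⟩ := this
    refine ⟨by simp [hα], by simp [hβ], α, h₁, h₂.inst_const ?_⟩
    rw [List.forall₂_iff_get] at he he' ⊢
    refine ⟨hl.symm, fun i hi hi' => ?_⟩
    have hi'' : i < es.length := by rw [he.1]; exact hi
    exact (he'.2 i hi'' hi').eval (he.2 i hi'' hi)
  | sel E C D κ p L P i hi Q =>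
    refine WT.communicate (κ := κ) (p := p) hA hP fun B₁ B₂ m₁ m₂ h₁ h₂ hd => ?_
    obtain ⟨-, α, hα, h₁⟩ := h₁
    obtain ⟨L', β, hi', hβ, h₂⟩ := h₂
    have := hd _ _ hα hβ
    simp only [STy.dual, STy.select.injEq] at this
    obtain ⟨rfl, this⟩ := this
    obtain rfl := eq_of_heq this
    exact ⟨by simp [hα], by simp [hβ], α ⟨i, hi⟩, h₁ _, h₂⟩
  | pass E C D κ κ' p q P Q =>
    obtain ⟨B₁, B₂, F, m₁, m₂, hs, hP, hQ, hfill⟩ := hP.fill_par_fill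
    obtain ⟨α, β, m, rfl, hne, hα, hβ, h₁⟩ := hP
    obtain ⟨α', β', hα', h₂⟩ := hQ
    have hp := p.ne_opp
    have s₁ := hs (.ch κ p)
    have s₂ := hs (.ch κ p.opp)
    have s₃ := hs (.ch κ' q)
    have hA₁ : A (.ch κ p) = some (.throwT β α) := by grind
    have hA₂ : A (.ch κ p.opp) = some (.catchT β' α') := by grind
    have := hA _ _ _ _ hA₁ hA₂
    simp only [STy.dual, STy.catchT.injEq] at this
    obtain ⟨rfl, rfl⟩ := this
    -- The passed endpoint is owned by the sender and the subject of the reception by the receiver.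
    -- Likewise the receiver does not own the passed endpoint yet, as `WT.inst_chan` requires.
    have hne' : Val.ch κ' q ≠ .ch κ p.opp := by rintro he; rw [he] at hβ s₃; grind
    have h₃ := h₂.inst_chan (κ := κ') (p := q) (by rw [Function.update_of_ne hne']; grind)
    -- The passed endpoint keeps its type and merely moves from one hole to the other, so only the
    -- endpoints of `κ` are updated; its move changes the counts by `-1` and `1`.
    have hr := hfill _ _
      (Function.update (Function.update A (.ch κ p) (some α)) (.ch κ p.opp) (some α.dual))
      _ _ _ _ (-1) 1 (by simp) (by simp) ?_ h₁ h₃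
    · obtain ⟨n', h⟩ := hr
      refine ⟨_, n', .of_channel κ p (by simp [hA₁]) (by simp [hA₂]) ?_ ?_, by simpa using h⟩
      · rw [Function.update_self, Function.update_of_ne (by simp [hp]), Function.update_self]
        rfl
      · intro k hk hk'
        rw [Function.update_of_ne hk', Function.update_of_ne hk]
    · intro k
      have := hs k
      simp only [Function.update_apply]
      grind
  | close E C D κ p P Q =>
    obtain ⟨B₁, B₂, F, m₁, m₂, hs, hP, hQ, hfill⟩ := hP.fill_par_fill
    obtain ⟨m, rfl, hα, h₁⟩ := hP
    obtain ⟨m', rfl, hβ, h₂⟩ := hQ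
    have hp := p.ne_opp
    have s₁ := hs (.ch κ p)
    have s₂ := hs (.ch κ p.opp)
    have hr := hfill _ _
      (Function.update (Function.update A (.ch κ p) none) (.ch κ p.opp) none)
      _ _ _ _ (-1) (-1) (by simp) (by simp) ?_ h₁ h₂
    · obtain ⟨n', h⟩ := hr
      refine ⟨_, n', .of_channel κ p (by grind) (by grind) ?_ ?_, by simpa using h⟩
      · rw [Function.update_self, Function.update_of_ne (by simp [hp]), Function.update_self]
        rfl
      · intro k hk hk'
        rw [Function.update_of_ne hk', Function.update_of_ne hk]
    · intro k
      have := hs k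
      simp only [Function.update_apply]
      grind
  | ifTr C e P Q _ =>
    obtain ⟨B, F, m, j, rfl, hs, h, hfill⟩ := hP.fill
    exact ⟨A, _, .refl A, by simpa using hfill P A B m 0 (by simp) hs h.2.1⟩
  | ifFa C e P Q _ =>
    obtain ⟨B, F, m, j, rfl, hs, h, hfill⟩ := hP.fill
    exact ⟨A, _, .refl A, by simpa using hfill Q A B m 0 (by simp) hs h.2.2⟩
  | str h₁ _ h₂ ih =>
    obtain ⟨A', n', hA', h⟩ := ih hA (h₁.wt_iff.1 hP)
    exact ⟨A', n', hA', h₂.wt_iff.1 h⟩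
  | par Q _ ih =>
    obtain ⟨B, C, m, j, rfl, hs, h₁, h₂⟩ := hP
    obtain ⟨B', m', hB', h⟩ := ih (hs.compat_left hA) h₁
    obtain ⟨hs', hA'⟩ := hB'.split hs
    exact ⟨_, _, hA', B', C, m', j, rfl, hs', h, h₂⟩
  | res _ ih =>
    obtain ⟨o, h⟩ := hP
    obtain ⟨B, m, hB, h⟩ := ih (hA.bindChan o) h
    obtain ⟨A', o', rfl, hA'⟩ := hB.of_bindChan
    exact ⟨A', m, hA', o', h⟩

/-! Runtime safety. -/

/-- A session of type `α` allows the action as its next one. -/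
def Action.Allowed : Action → STy → Prop
  | .out n, .send τs _ => τs.length = n
  | .inp n, .recv τs _ => τs.length = n
  | .throwS, .throwT _ _ => True
  | .catchS, .catchT _ _ => True
  | .branch L, .branch L' _ => L = L'
  | .select n, .select L _ => n ∈ L
  | .close, .closed => True
  | _, _ => False

theorem Action.Allowed.matches {a b : Action} {α : STy} (ha : a.Allowed α)
    (hb : b.Allowed α.dual) : Matches a b ∨ Matches b a := by
  cases a <;> cases α <;> simp only [Action.Allowed] at ha <;> cases b <;>
    simp only [Action.Allowed, STy.dual] at hb
  · subst ha hb; exact .inl (.comm _)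
  · subst ha hb; exact .inr (.comm _)
  · exact .inl .pass
  · exact .inr .pass
  · subst ha; exact .inr (.sel _ _ hb)
  · subst hb; exact .inl (.sel _ _ ha)
  · exact .inl .close

/-- The prefixes on `κ` use different endpoints, and their actions are allowed by the types. -/
theorem WT.kprocs {Γ : Env} {P : Proc} {A : Asg} {n : ℕ} (h : WT Γ P A n) (κ : ℕ) :
    (∀ x ∈ P.kprocs κ, ∃ α, A (.ch κ x.1) = some α ∧ x.2.Allowed α) ∧
      ((P.kprocs κ).map Prod.fst).Nodup := by
  have on : ∀ {A : Asg} {κ : ℕ} {k : Val} {a : Action} {α : STy}, A k = some α →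
      a.Allowed α → (∀ x ∈ onChan κ k a, ∃ α, A (.ch κ x.1) = some α ∧ x.2.Allowed α) ∧
      ((onChan κ k a).map Prod.fst).Nodup := by
    intro A κ k a α hk ha
    cases k with
    | ch κ' p =>
      simp only [onChan]
      split
      · next h =>
        subst h
        simp only [Multiset.mem_singleton, forall_eq, Multiset.map_singleton,
          Multiset.nodup_singleton, and_true]
        exact ⟨α, hk, ha⟩
      · simp
    | _ => simp [onChan]
  induction P generalizing Γ A n κ with
  | out k es P ih =>
    obtain ⟨τs, α, h₁, h₂, -⟩ := h
    exact on h₂ h₁.length_eq.symm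
  | inp k m P ih =>
    obtain ⟨τs, α, h₁, h₂, -⟩ := h
    exact on h₂ h₁
  | throwS k k' P ih =>
    obtain ⟨α, β, m, -, -, h, -⟩ := h
    exact on h trivial
  | catchS k P ih =>
    obtain ⟨α, β, h, -⟩ := h
    exact on h trivial
  | branch k L P ih =>
    obtain ⟨-, α, h, -⟩ := h
    exact on h rfl
  | select k i P ih =>
    obtain ⟨L, α, hi, h, -⟩ := h
    exact on h hi
  | close k P ih =>
    obtain ⟨m, -, h, -⟩ := h
    exact on h trivial
  | loc l z P ih =>
    obtain ⟨m, j, -, -, h⟩ := h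
    exact ih h κ
  | res P ih =>
    obtain ⟨o, h⟩ := h
    have := ih h (κ + 1)
    simp only [Asg.bindChan_succ] at this
    exact this
  | par P Q ihP ihQ =>
    obtain ⟨B, C, m, j, -, hs, h₁, h₂⟩ := h
    obtain ⟨hP, hP'⟩ := ihP h₁ κ
    obtain ⟨hQ, hQ'⟩ := ihQ h₂ κ
    constructor
    · intro x hx
      have := hs (.ch κ x.1)
      rcases Multiset.mem_add.1 hx with hx | hx
      · obtain ⟨α, hα, ha⟩ := hP x hx
        exact ⟨α, by grind, ha⟩
      · obtain ⟨α, hα, ha⟩ := hQ x hx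
        exact ⟨α, by grind, ha⟩
    · simp only [Proc.kprocs]
      rw [Multiset.map_add, Multiset.nodup_add]
      -- Prefixes with the same endpoint on both sides would make it a key of both components.
      refine ⟨hP', hQ', Multiset.disjoint_left.2 fun {p} hp hp' => ?_⟩
      obtain ⟨x, hx, rfl⟩ := Multiset.mem_map.1 hp
      obtain ⟨y, hy, hxy⟩ := Multiset.mem_map.1 hp'
      obtain ⟨α, hα, -⟩ := hP x hx
      obtain ⟨β, hβ, -⟩ := hQ y hy
      have := hs (.ch κ x.1)
      rw [hxy] at hβ
      grind
  | _ => simp [Proc.kprocs]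

theorem Pol.card_le_two {s : Multiset Pol} (h : s.Nodup) : Multiset.card s ≤ 2 := by
  have : s ≤ {.pos, .neg} := (Multiset.le_iff_subset h).2 fun p _ => by cases p <;> simp
  simpa using Multiset.card_le_card this

theorem Pol.eq_opp_of_ne {p q : Pol} (h : p ≠ q) : q = p.opp := by
  cases p <;> cases q <;> simp_all [Pol.opp]

theorem WT.of_resN {Γ : Env} {P : Proc} {k : ℕ} {A : Asg} {n : ℕ} (h : WT Γ (P.resN k) A n)
    (hA : A.Compat) : ∃ B : Asg, B.Compat ∧ WT Γ P B n := by
  induction k generalizing A with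
  | zero => exact ⟨A, hA, h⟩
  | succ k ih =>
    obtain ⟨o, h⟩ := h
    exact ih h (hA.bindChan o)

/-- The polarities of the prefixes on a channel are distinct, which excludes three of them. Two
prefixes have opposite polarities and are allowed by dual types, so they match. -/
theorem WT.not_isError {Γ : Env} {P : Proc} {A : Asg} {n : ℕ} (h : WT Γ P A n)
    (hA : A.Compat) : ¬ IsError P := by
  rintro ⟨k, Q, κ, hc, he⟩
  obtain ⟨B, hB, hQ⟩ := (hc.wt_iff.1 h).of_resN hA
  obtain ⟨h₁, h₂⟩ := hQ.kprocs κ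
  rcases he with ⟨x, y, hxy, hr⟩ | he
  · rw [hxy] at h₁ h₂
    obtain ⟨α, hα, hx⟩ := h₁ x (by simp)
    obtain ⟨β, hβ, hy⟩ := h₁ y (by simp)
    have hp : y.1 = x.1.opp := Pol.eq_opp_of_ne (by simpa using h₂)
    rw [hp] at hβ
    obtain rfl := hB _ _ _ _ hα hβ
    exact hr ⟨hp, hx.matches hy⟩
  · have := Pol.card_le_two h₂
    rw [Multiset.card_map] at this
    omega

theorem Typing.Balanced.compat {Δ : Typing} {A : Asg} (h : Δ.Balanced) (hA : Δ.Rep A) :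
    A.Compat := by
  intro κ p α β h₁ h₂
  have := h.1 κ p α ((hA.mem_iff _ _).2 h₁)
  rw [hA.mem_iff, h₂, Option.some.injEq] at this
  exact this

end SessAdapt

theorem theorem2 (Γ : SessAdapt.Env) (Θ : SessAdapt.HEnv) (P : SessAdapt.Proc)
    (Δ : SessAdapt.Typing) (I : SessAdapt.Interface)
    (hP : SessAdapt.Typed Γ Θ P Δ I) (hΔ : Δ.Balanced) :
    ∀ Q : SessAdapt.Proc, Relation.ReflTransGen SessAdapt.Red P Q → ¬ SessAdapt.IsError Q := by
  intro Q hQ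
  obtain ⟨A, hA, h⟩ := hP.wt
  -- The invariant leaves the assignment and the count open, since both may change at every
  -- reduction step.
  suffices ∃ B n, B.Compat ∧ SessAdapt.WT Γ Q B n by
    obtain ⟨B, n, hB, h⟩ := this
    exact h.not_isError hB
  induction hQ with
  | refl => exact ⟨A, _, hΔ.compat hA, h⟩
  | tail _ hr ih =>
    obtain ⟨B, n, hB, h⟩ := ih
    obtain ⟨B', n', hB', h'⟩ := hr.wt hB h
    exact ⟨B', n', hB'.compat hB, h'⟩
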